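/- Let $\Gamma$ be a group. A $\Gamma$-group is a group $G$ on which $\Gamma$ acts by automorphisms, written $(\sigma,g)\mapsto{}^{\sigma}g$; a $\Gamma$-map is a map of sets commuting with the actions of $\Gamma$. For a normal $\Gamma$-stable subgroup $H$ of a $\Gamma$-group $G$ let $[G,H]_\Gamma$ be the subgroup of $G$ generated by the elements $x\,{}^{\sigma}y\,x^{-1}y^{-1}$ with $x\in G$, $y\in H$, $\sigma\in\Gamma$; $G$ is $\Gamma$-perfect if $[G,G]_\Gamma=G$. A central $\Gamma$-equivariant extension of $G$ is a homomorphism of $\Gamma$-groups $\beta:U\to G$ that has a section which is a $\Gamma$-map (so $\beta$ is surjective) and whose kernel lies in the center of $U$ and is fixed elementwise by $\Gamma$; it is universal if for every central $\Gamma$-equivariant extension $\alpha:X\to G$ there is a unique homomorphism of $\Gamma$-groups $f:U\to X$ with $\alpha f=\beta$. For a $\Gamma$-group $P$ let $F(P)$ be the free group on the set $P$ with $\Gamma$ acting by ${}^{\sigma}|p|=|{}^{\sigma}p|$; $P$ is projective if the canonical homomorphism $F(P)\to P$, $|p|\mapsto p$, has a section that is a homomorphism of $\Gamma$-groups. A projective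 presentation of $G$ is a homomorphism of $\Gamma$-groups $\tau:P\to G$ with $P$ projective that has a section which is a $\Gamma$-map. A $G\rtimes\Gamma$-module is relatively free if it is free as a $G$-module with a basis that is a $\Gamma$-subset, and relatively projective if it is a retract of a relatively free one. Let $H_n^\Gamma(G)=H_n(Q_*\otimes_{G\rtimes\Gamma}\mathbb{Z})$, where $G$ and $\Gamma$ act trivially on $\mathbb{Z}$ and $Q_*\to\mathbb{Z}$ is any resolution of $\mathbb{Z}$ by relatively projective $G\rtimes\Gamma$-modules in which the surjections $Q_0\to\mathbb{Z}$, $Q_1\to\operatorname{Ker}(Q_0\to\mathbb{Z})$ and $Q_{n+1}\to\operatorname{Ker}(Q_n\to Q_{n-1})$, $n\ge1$, all have sections that are $\Gamma$-maps. Theorem. Let $\tau:P\to G$ be a projective presentation of a $\Gamma$-group $G$ with kernel $R$. (i) If $G$ is $\Gamma$-perfect, then the homomorphism $[P,P]_\Gamma/[P,R]_\Gamma\to G$ induced by $\tau$ is a universal central $\Gamma$-equivariant extension of $G$. (ii) For any $\Gamma$-group $G$ there is an isomorphism of groups $H_2^\Gamma(G)\cong (R\cap[P,P]_\Gamma)/[P,R]_\Gamma$.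 -/

import Mathlib

open CategoryTheory

universe uΓ uG uP uX uM uA

/-! ### `Γ`-groups: commutators, central extensions, projective presentations

A `Γ`-group is a group `G` with an action of the group `Γ` by automorphisms, that is an instance of
`MulDistribMulAction Γ G`. A homomorphism of `Γ`-groups is a term of `G →*[Γ] H`, and a `Γ`-map
(an equivariant map of sets) is a term of `G →[Γ] H`. -/

namespace GammaGroup

section Commutators

variable (Γ : Type uΓ) [Group Γ] {G : Type uG} [Group G] [MulDistribMulAction Γ G]

/-- The subgroup `[G, H]_Γ` generated by the `Γ`-commutators `x · ᵟy · x⁻¹ · y⁻¹`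
with `x ∈ G`, `y ∈ H` and `δ ∈ Γ`. -/
def commutator (H : Subgroup G) : Subgroup G :=
  Subgroup.closure {z | ∃ x : G, ∃ y ∈ H, ∃ σ : Γ, z = x * (σ • y) * x⁻¹ * y⁻¹}

variable (G) in
/-- The `Γ`-commutator subgroup `[G, G]_Γ`. -/
def derived : Subgroup G := commutator Γ (⊤ : Subgroup G)

variable (G) in
/-- `G` is `Γ`-perfect if it coincides with its `Γ`-commutator subgroup. -/
def IsPerfect : Prop := derived Γ G = ⊤

lemma commutator_le_derived (H : Subgroup G) : commutator Γ H ≤ derived Γ G := by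
  apply Subgroup.closure_mono
  rintro z ⟨x, y, -, σ, rfl⟩
  exact ⟨x, y, trivial, σ, rfl⟩

lemma smul_mem_commutator {H : Subgroup G} (hH : ∀ (σ : Γ), ∀ y ∈ H, σ • y ∈ H) (σ : Γ) {z : G}
    (hz : z ∈ commutator Γ H) : σ • z ∈ commutator Γ H := by
  induction hz using Subgroup.closure_induction with
  | mem z hz =>
    obtain ⟨x, y, hy, δ, rfl⟩ := hz
    refine Subgroup.subset_closure ⟨σ • x, σ • y, hH σ y hy, σ * δ * σ⁻¹, ?_⟩
    simp [smul_mul', smul_inv', smul_smul]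
  | one => simp
  | mul a b _ _ ha hb => rw [smul_mul']; exact mul_mem ha hb
  | inv a _ ha => rw [smul_inv']; exact inv_mem ha

lemma smul_mem_derived (σ : Γ) {z : G} (hz : z ∈ derived Γ G) : σ • z ∈ derived Γ G :=
  smul_mem_commutator Γ (fun _ _ _ => Subgroup.mem_top _) σ hz

lemma commutator_normal (H : Subgroup G) : (commutator Γ H).Normal := by
  refine ⟨fun z hz p => ?_⟩
  induction hz using Subgroup.closure_induction with
  | mem z hz =>
    obtain ⟨x, y, hy, δ, rfl⟩ := hz
    have h1 : p * x * (δ • y) * (p * x)⁻¹ * y⁻¹ ∈ commutator Γ H :=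
      Subgroup.subset_closure ⟨p * x, y, hy, δ, rfl⟩
    have h2 : p * ((1 : Γ) • y) * p⁻¹ * y⁻¹ ∈ commutator Γ H :=
      Subgroup.subset_closure ⟨p, y, hy, 1, rfl⟩
    have := mul_mem h1 (inv_mem h2)
    convert this using 1
    simp only [one_smul]
    group
  | one => simp
  | mul a b _ _ ha hb =>
    have := mul_mem ha hb
    convert this using 1
    group
  | inv a _ ha =>
    have := inv_mem ha
    convert this using 1
    group

/-- The `Γ`-commutator subgroup is generated by the commutators and the elements `ᵟg · g⁻¹`. -/
lemma derived_eq : derived Γ G = Subgroup.closure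
    ({z | ∃ x y : G, z = x * y * x⁻¹ * y⁻¹} ∪ {z | ∃ (σ : Γ) (g : G), z = (σ • g) * g⁻¹}) := by
  apply le_antisymm
  · refine (Subgroup.closure_le _).2 ?_
    rintro _ ⟨x, y, -, σ, rfl⟩
    have h1 := Subgroup.subset_closure
      (Set.mem_union_left {z | ∃ (σ : Γ) (g : G), z = (σ • g) * g⁻¹}
        (show x * (σ • y) * x⁻¹ * (σ • y)⁻¹ ∈ {z | ∃ x y : G, z = x * y * x⁻¹ * y⁻¹} from
          ⟨x, σ • y, rfl⟩))
    have h2 := Subgroup.subset_closure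
      (Set.mem_union_right {z | ∃ x y : G, z = x * y * x⁻¹ * y⁻¹}
        (show (σ • y) * y⁻¹ ∈ {z | ∃ (σ : Γ) (g : G), z = (σ • g) * g⁻¹} from ⟨σ, y, rfl⟩))
    have := mul_mem h1 h2
    rw [← mul_assoc, inv_mul_cancel_right] at this
    exact this
  · refine (Subgroup.closure_le _).2 ?_
    rintro _ (⟨x, y, rfl⟩ | ⟨σ, g, rfl⟩)
    · exact Subgroup.subset_closure ⟨x, y, Subgroup.mem_top _, 1, by simp⟩
    · exact Subgroup.subset_closure ⟨1, g, Subgroup.mem_top _, σ, by simp⟩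

/-- The action of `Γ` on the `Γ`-commutator subgroup. -/
instance : MulDistribMulAction Γ (derived Γ G) where
  smul σ z := ⟨σ • (z : G), smul_mem_derived Γ σ z.2⟩
  one_smul z := Subtype.ext (one_smul Γ (z : G))
  mul_smul σ δ z := Subtype.ext (mul_smul σ δ (z : G))
  smul_mul σ a b := Subtype.ext (smul_mul' σ (a : G) (b : G))
  smul_one σ := Subtype.ext (smul_one σ)

end Commutators

section Extensions

variable {Γ : Type uΓ} [Group Γ] {G : Type uG} [Group G] [MulDistribMulAction Γ G]
  {U : Type uP} [Group U] [MulDistribMulAction Γ U]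

/-- `(U, β)` is a central `Γ`-equivariant extension of `G`: the homomorphism of `Γ`-groups `β` has
a section that is a `Γ`-map (in particular it is surjective), its kernel is contained in the
center of `U`, and `Γ` acts trivially on the kernel. -/
structure IsCentralExtension (β : U →*[Γ] G) : Prop where
  exists_section : ∃ γ : G →[Γ] U, ∀ g, β (γ g) = g
  ker_le_center : β.toMonoidHom.ker ≤ Subgroup.center U
  smul_eq_of_mem_ker : ∀ (σ : Γ), ∀ a ∈ β.toMonoidHom.ker, σ • a = a

/-- `(U, β)` is a universal central `Γ`-equivariant extension of `G`: to any other one there is a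
unique homomorphism of `Γ`-groups over `G`. -/
def IsUniversalCentralExtension (β : U →*[Γ] G) : Prop :=
  IsCentralExtension β ∧
    ∀ (X : Type uX) [Group X] [MulDistribMulAction Γ X] (α : X →*[Γ] G), IsCentralExtension α →
      ∃! f : U →*[Γ] X, ∀ u, α (f u) = β u

end Extensions

section Presentations

/-- `P` belongs to the projective class of the free cotriple on `Γ`-groups: the canonical
homomorphism `F(P) → P`, `|p| ↦ p`, has a section that is a homomorphism of `Γ`-groups, where `F(P)`
is the free group on the set `P` with the action `ᵟ|p| = |ᵟp|`. -/
def IsProjective (Γ : Type uΓ) [Group Γ] (P : Type uP) [Group P] [MulDistribMulAction Γ P] : Prop :=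
  ∃ s : P →* FreeGroup P,
    (∀ (σ : Γ) (p : P), s (σ • p) = FreeGroup.map (fun q : P => σ • q) (s p)) ∧
    ∀ p, FreeGroup.lift id (s p) = p

variable {Γ : Type uΓ} [Group Γ] {G : Type uG} [Group G] [MulDistribMulAction Γ G]
  {P : Type uP} [Group P] [MulDistribMulAction Γ P]

/-- `τ : P → G` is a projective presentation of the `Γ`-group `G`: `P` is a projective `Γ`-group
and `τ` is surjective and `Γ`-splitting, i.e. has a section that is a `Γ`-map. -/
structure IsProjectivePresentation (τ : P →*[Γ] G) : Prop where
  projective : IsProjective Γ P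
  exists_section : ∃ γ : G →[Γ] P, ∀ g, τ (γ g) = g

/-- The kernel `R` of a homomorphism `τ : P → G` of `Γ`-groups. -/
def ker (τ : P →*[Γ] G) : Subgroup P := τ.toMonoidHom.ker

lemma mem_ker {τ : P →*[Γ] G} {x : P} : x ∈ ker τ ↔ τ x = 1 := Iff.rfl

lemma smul_mem_ker (τ : P →*[Γ] G) (σ : Γ) (y : P) (hy : y ∈ ker τ) : σ • y ∈ ker τ := by
  rw [mem_ker] at hy ⊢
  rw [map_smul, hy, smul_one]

/-- The subgroup `[P, R]_Γ` of `P`, where `R` is the kernel of `τ : P → G`. -/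
def kerCommutator (τ : P →*[Γ] G) : Subgroup P := commutator Γ (ker τ)

instance (τ : P →*[Γ] G) : (kerCommutator τ).Normal :=
  commutator_normal Γ _

lemma kerCommutator_le_ker (τ : P →*[Γ] G) : kerCommutator τ ≤ ker τ := by
  refine (Subgroup.closure_le _).2 ?_
  rintro z ⟨x, y, hy, σ, rfl⟩
  rw [mem_ker] at hy
  simp [mem_ker, hy]

/-- The group `[P, P]_Γ / [P, R]_Γ`, where `R` is the kernel of `τ : P → G`. -/
abbrev DerivedQuotient (τ : P →*[Γ] G) : Type uP :=
  derived Γ P ⧸ (kerCommutator τ).subgroupOf (derived Γ P)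

/-- The action of `Γ` on `[P, P]_Γ / [P, R]_Γ` induced by the one on `P`. -/
instance (τ : P →*[Γ] G) : MulDistribMulAction Γ (DerivedQuotient τ) where
  smul σ := QuotientGroup.map ((kerCommutator τ).subgroupOf (derived Γ P))
    ((kerCommutator τ).subgroupOf (derived Γ P)) (MulDistribMulAction.toMonoidHom (derived Γ P) σ)
    fun z (hz : (z : P) ∈ kerCommutator τ) =>
      (smul_mem_commutator Γ (smul_mem_ker τ) σ hz : σ • (z : P) ∈ kerCommutator τ)
  one_smul z := by
    induction z using QuotientGroup.induction_on with
    | H z => exact congrArg _ (one_smul Γ z)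
  mul_smul σ δ z := by
    induction z using QuotientGroup.induction_on with
    | H z => exact congrArg _ (mul_smul σ δ z)
  smul_mul σ a b := map_mul _ a b
  smul_one σ := map_one _

/-- The homomorphism of `Γ`-groups `τ' : [P, P]_Γ / [P, R]_Γ → G` induced by `τ : P → G`. -/
def derivedQuotientMap (τ : P →*[Γ] G) : DerivedQuotient τ →*[Γ] G where
  __ := QuotientGroup.lift _ (τ.toMonoidHom.comp (derived Γ P).subtype)
    fun z hz => kerCommutator_le_ker τ (x := (z : P)) hz
  map_smul' σ z := by
    induction z using QuotientGroup.induction_on with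
    | H z => exact map_smul τ σ (z : P)

/-- The group `(R ∩ [P, P]_Γ) / [P, R]_Γ`, where `R` is the kernel of `τ : P → G`. -/
abbrev HopfQuotient (τ : P →*[Γ] G) : Type uP :=
  ↥(ker τ ⊓ derived Γ P) ⧸ (kerCommutator τ).subgroupOf (ker τ ⊓ derived Γ P)

end Presentations

end GammaGroup

/-! ### Equivariant homology of `Γ`-groups

`Γ`-equivariant `G`-modules are modules over the semidirect product `G ⋊ Γ`, that is objects of
`Rep ℤ (G ⋊ Γ)`. (The definitions make sense over any commutative ring `k` in place of `ℤ`.) The equivariant homology of `G` is the `Tor` functor relative to the class of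
retracts of `G ⋊ Γ`-modules that are free over `G` with a basis permuted by `Γ`. -/

namespace EquivariantHomology

noncomputable section

/-- The semidirect product `G ⋊ Γ` attached to a `Γ`-group `G`. -/
abbrev Semidirect (Γ : Type uΓ) [Group Γ] (G : Type uG) [Group G] [MulDistribMulAction Γ G] :
    Type (max uΓ uG) :=
  G ⋊[MulDistribMulAction.toMulAut Γ G] Γ

variable {Γ : Type uΓ} [Group Γ] {G : Type uG} [Group G] [MulDistribMulAction Γ G]
  {k : Type} [CommRing k]

/-- A `G ⋊ Γ`-module is relatively free if it has a subset `S`, stable under `Γ`, which is a basis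
of it as a `G`-module: the elements `g s`, for `g ∈ G` and `s ∈ S`, form a basis over `k`. -/
def IsRelativelyFree (M : Rep.{uM} k (Semidirect Γ G)) : Prop :=
  ∃ S : Set M,
    (∀ (σ : Γ), ∀ s ∈ S, M.ρ (SemidirectProduct.inr σ) s ∈ S) ∧
    LinearIndependent k (fun x : G × S => M.ρ (SemidirectProduct.inl x.1) (x.2 : M)) ∧
    Submodule.span k
      (Set.range (fun x : G × S => M.ρ (SemidirectProduct.inl x.1) (x.2 : M))) = ⊤

/-- A `G ⋊ Γ`-module is relatively projective if it is a retract of a relatively free one. -/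
def IsRelativelyProjective (M : Rep.{uM} k (Semidirect Γ G)) : Prop :=
  ∃ (F : Rep.{uM} k (Semidirect Γ G)) (i : M ⟶ F) (r : F ⟶ M), IsRelativelyFree F ∧ i ≫ r = 𝟙 M

/-- The sequence `A → B → C` of `G ⋊ Γ`-modules is a complex and `A` maps onto the kernel of
`B → C`, with a section that is a `Γ`-map (not necessarily additive). -/
def IsProperExact {A B C : Rep.{uM} k (Semidirect Γ G)} (f : A ⟶ B) (g : B ⟶ C) : Prop :=
  f ≫ g = 0 ∧ ∃ γ : B → A, ∀ b : B, g.hom b = 0 →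
    f.hom (γ b) = b ∧
    ∀ σ : Γ, γ (B.ρ (SemidirectProduct.inr σ) b) = A.ρ (SemidirectProduct.inr σ) (γ b)

/-- A relatively projective resolution of the `G ⋊ Γ`-module `M`. -/
structure RelativeResolution (M : Rep.{uM} k (Semidirect Γ G)) where
  /-- the complex `⋯ → X₁ → X₀` -/
  complex : ChainComplex (Rep.{uM} k (Semidirect Γ G)) ℕ
  /-- the augmentation `X₀ → M` -/
  augmentation : complex.X 0 ⟶ M
  projective : ∀ n, IsRelativelyProjective (complex.X n)
  exact_aug : IsProperExact augmentation (0 : M ⟶ M)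
  exact_zero : IsProperExact (complex.d 1 0) augmentation
  exact_succ : ∀ n, IsProperExact (complex.d (n + 2) (n + 1)) (complex.d (n + 1) n)

/-- The functor `- ⊗ A` over `G ⋊ Γ`: it sends `B` to the quotient of `B ⊗ A` (over `k`) by the
submodule generated by the elements `x b ⊗ x a - b ⊗ a` with `x ∈ G ⋊ Γ`. -/
def tensorFunctor (A : Rep.{uA} k (Semidirect Γ G)) :
    Rep.{uM} k (Semidirect Γ G) ⥤ ModuleCat.{max uM uA} k where
  obj B := ModuleCat.of k (Representation.Coinvariants (B.ρ.tprod A.ρ))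
  map f := ModuleCat.ofHom
    (Representation.Coinvariants.map _ _ (f.hom.tensor (Representation.IntertwiningMap.id A.ρ)))
  map_id _ := ModuleCat.hom_ext (Representation.Coinvariants.hom_ext (TensorProduct.ext' fun _ _ => rfl))
  map_comp _ _ :=
    ModuleCat.hom_ext (Representation.Coinvariants.hom_ext (TensorProduct.ext' fun _ _ => rfl))

instance (A : Rep.{uA} k (Semidirect Γ G)) : (tensorFunctor.{uΓ, uG, uM} A).Additive where
  map_add {_ _ f g} := ModuleCat.hom_ext (Representation.Coinvariants.hom_ext
    (TensorProduct.ext' fun b a =>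
      (congrArg (Representation.Coinvariants.mk _)
        (TensorProduct.add_tmul (R := k) (f.hom b) (g.hom b) a)).trans (map_add _ _ _)))

/-- The relative `Tor_n(M, A)` over `G ⋊ Γ`, computed with the relatively projective
resolution `Q` of `M`. -/
def relativeTor {M : Rep.{uM} k (Semidirect Γ G)} (Q : RelativeResolution M)
    (A : Rep.{uA} k (Semidirect Γ G)) (n : ℕ) : ModuleCat.{max uM uA} k :=
  (((tensorFunctor A).mapHomologicalComplex (ComplexShape.down ℕ)).obj Q.complex).homology n

variable (Γ G k) in
/-- The trivial `G ⋊ Γ`-module `k`, in any universe. -/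
abbrev trivialModule : Rep.{uM} k (Semidirect Γ G) :=
  Rep.trivial k (Semidirect Γ G) (ULift.{uM} k)

/-- The equivariant homology `H_n^Γ(G, A)` of the `Γ`-group `G` with coefficients in the
`G ⋊ Γ`-module `A`: the relative `Tor_n(ℤ, A)` over `G ⋊ Γ`, computed with the relatively
projective resolution `Q` of the trivial module `ℤ`. -/
abbrev equivariantHomology (Q : RelativeResolution (trivialModule.{uΓ, uG, uM} Γ G ℤ))
    (A : Rep.{uA} ℤ (Semidirect Γ G)) (n : ℕ) : ModuleCat.{max uM uA} ℤ :=
  relativeTor Q A n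

/-- The integral equivariant homology `H_n^Γ(G) = H_n^Γ(G, ℤ)`, with `G` and `Γ` acting trivially
on `ℤ`. -/
abbrev integralHomology (Q : RelativeResolution (trivialModule.{uΓ, uG, uM} Γ G ℤ)) (n : ℕ) :
    ModuleCat.{uM} ℤ :=
  equivariantHomology Q (trivialModule.{uΓ, uG, 0} Γ G ℤ) n

/-! ### Existence of relatively projective resolutions -/

section Existence

variable {A B : Rep.{max uG uM} k (Semidirect Γ G)} (f : A ⟶ B)

/-- The kernel of `f`, as a set with an action of `Γ`. -/
abbrev KerSet : Type (max uG uM) := {a : A // f.hom a = 0}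

/-- The action of `G ⋊ Γ` on `G × Ker f`, given by `ᵗ(h, a) = (g · ᵟh, ᵟa)` for `t = (g, δ)`. -/
def act (t : Semidirect Γ G) (x : G × KerSet f) : G × KerSet f :=
  (t.left * t.right • x.1, ⟨A.ρ (SemidirectProduct.inr t.right) x.2, by
    rw [Rep.hom_comm_apply, x.2.2, map_zero]⟩)

/-- The `G ⋊ Γ`-module freely generated over `G` by the `Γ`-set `Ker f`. -/
def freeOnKer : Rep.{max uG uM} k (Semidirect Γ G) :=
  Rep.of (X := G × KerSet f →₀ k)
    { toFun := fun t => Finsupp.lmapDomain k k (act f t)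
      map_one' := by
        have : act f 1 = id := by
          funext x
          refine Prod.ext ?_ (Subtype.ext ?_)
          · simp [act]
          · simp [act]
        rw [this, Finsupp.lmapDomain_id]
        rfl
      map_mul' := fun t t' => by
        have : act f (t * t') = act f t ∘ act f t' := by
          funext x
          refine Prod.ext ?_ (Subtype.ext ?_)
          · simp [act, mul_assoc, mul_smul]
          · simp [act]
        rw [this, Finsupp.lmapDomain_comp]
        rfl }

/-- The canonical homomorphism from the module freely generated over `G` by `Ker f`. -/
def freeOnKerMap : freeOnKer f ⟶ A :=
  Rep.ofHom (LinearMap.intertwiningMap_of_isIntertwiningMap _ _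
    (Finsupp.linearCombination k
      fun x : G × KerSet f => A.ρ (SemidirectProduct.inl x.1) (x.2 : A)) (by
    intro t v
    induction v using Finsupp.induction_linear with
    | zero => simp
    | add v w hv hw => simp only [map_add, hv, hw]
    | single x n =>
      change Finsupp.linearCombination k _ (Finsupp.mapDomain (act f t) (Finsupp.single x n)) = _
      rw [Finsupp.mapDomain_single, Finsupp.linearCombination_single,
        Finsupp.linearCombination_single, map_smul]
      congr 1
      simp only [act]
      rw [← Module.End.mul_apply, ← Module.End.mul_apply, ← map_mul, ← map_mul]
      congr 2
      ext <;> simp))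

lemma freeOnKerMap_single (x : G × KerSet f) (n : k) :
    (freeOnKerMap f).hom (Finsupp.single x n : G × KerSet f →₀ k) =
      n • A.ρ (SemidirectProduct.inl x.1) (x.2 : A) :=
  Finsupp.linearCombination_single k _ _

lemma freeOnKer_ρ_single (t : Semidirect Γ G) (x : G × KerSet f) (n : k) :
    (freeOnKer f).ρ t (Finsupp.single x n : G × KerSet f →₀ k) =
      (Finsupp.single (act f t x) n : G × KerSet f →₀ k) :=
  Finsupp.mapDomain_single

lemma isProperExact_freeOnKerMap : IsProperExact (freeOnKerMap f) f := by
  classical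
  refine ⟨?_, fun a => if h : f.hom a = 0 then
    (Finsupp.single (1, ⟨a, h⟩) 1 : G × KerSet f →₀ k) else 0, ?_⟩
  · ext v
    change f.hom ((freeOnKerMap f).hom v) = 0
    induction v using Finsupp.induction_linear with
    | zero => exact (congrArg _ (map_zero _)).trans (map_zero _)
    | add v w hv hw =>
      exact (congrArg _ (map_add _ _ _)).trans ((map_add _ _ _).trans (by rw [hv, hw, add_zero]))
    | single x n =>
      rw [freeOnKerMap_single, map_smul, Rep.hom_comm_apply, x.2.2, map_zero, smul_zero]
  · intro a ha
    have ha' : ∀ σ : Γ, f.hom (A.ρ (SemidirectProduct.inr σ) a) = 0 := fun σ => by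
      rw [Rep.hom_comm_apply, ha, map_zero]
    refine ⟨?_, fun σ => ?_⟩
    · beta_reduce
      refine (congrArg (freeOnKerMap f).hom (dif_pos ha)).trans ?_
      rw [freeOnKerMap_single]
      simp
    · refine (dif_pos (ha' σ)).trans (Eq.trans ?_
        (congrArg ((freeOnKer f).ρ (SemidirectProduct.inr σ)) (dif_pos ha)).symm)
      rw [freeOnKer_ρ_single]
      simp [act]
      rfl

lemma isRelativelyFree_freeOnKer : IsRelativelyFree (freeOnKer f) := by
  let v : KerSet f → freeOnKer f := fun a => (Finsupp.single (1, a) 1 : G × KerSet f →₀ k)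
  let b : Module.Basis (G × KerSet f) k (G × KerSet f →₀ k) := Finsupp.basisSingleOne
  have hb (g : G) (a : KerSet f) :
      (freeOnKer f).ρ (SemidirectProduct.inl g) (v a) = b (g, a) := by
    refine (freeOnKer_ρ_single f _ _ _).trans ?_
    simp [act, b]
    rfl
  choose c hc using fun s : Set.range v => s.2
  have hfun : (fun x : G × Set.range v =>
      (freeOnKer f).ρ (SemidirectProduct.inl x.1) (x.2 : freeOnKer f)) =
      b ∘ fun x => (x.1, c x.2) := by
    funext x
    rw [Function.comp_apply, ← hb, hc]
  refine ⟨Set.range v, ?_, ?_, ?_⟩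
  · rintro σ _ ⟨a, rfl⟩
    refine ⟨(act f (SemidirectProduct.inr σ) (1, a)).2, ?_⟩
    refine Eq.trans ?_ (freeOnKer_ρ_single f _ _ _).symm
    simp [act, v]
    rfl
  · rw [hfun]
    refine b.linearIndependent.comp _ ?_
    rintro ⟨g, s⟩ ⟨g', s'⟩ h
    obtain ⟨h1, h2⟩ := Prod.mk.inj h
    refine Prod.ext h1 (Subtype.ext ?_)
    rw [← hc s, ← hc s', h2]
  · rw [eq_top_iff]
    refine b.span_eq.symm.le.trans (Submodule.span_mono ?_)
    rintro _ ⟨⟨g, a⟩, rfl⟩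
    exact ⟨(g, ⟨v a, a, rfl⟩), hb g a⟩

lemma isRelativelyProjective_freeOnKer : IsRelativelyProjective (freeOnKer f) :=
  ⟨_, 𝟙 _, 𝟙 _, isRelativelyFree_freeOnKer f, Category.comp_id _⟩

/-- The homomorphisms of the resolution obtained by iterating the construction `freeOnKer`,
starting with the zero endomorphism of `M`. -/
def iterMap (M : Rep.{max uG uM} k (Semidirect Γ G)) :
    ℕ → (A B : Rep.{max uG uM} k (Semidirect Γ G)) × (A ⟶ B)
  | 0 => ⟨M, M, 0⟩
  | n + 1 => ⟨freeOnKer (iterMap M n).2.2, (iterMap M n).1, freeOnKerMap (iterMap M n).2.2⟩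

/-- The differentials of the resolution obtained by iterating `freeOnKer`. -/
def iterD (M : Rep.{max uG uM} k (Semidirect Γ G)) (n : ℕ) :
    (iterMap M (n + 2)).1 ⟶ (iterMap M (n + 1)).1 :=
  freeOnKerMap (iterMap M (n + 1)).2.2

lemma isProperExact_iterD (M : Rep.{max uG uM} k (Semidirect Γ G)) (n : ℕ) :
    IsProperExact (iterD M (n + 1)) (iterD M n) :=
  isProperExact_freeOnKerMap (iterD M n)

lemma iterD_comp (M : Rep.{max uG uM} k (Semidirect Γ G)) (n : ℕ) :
    iterD M (n + 1) ≫ iterD M n = 0 :=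
  (isProperExact_iterD M n).1

/-- The complex obtained by iterating `freeOnKer`. -/
def iterComplex (M : Rep.{max uG uM} k (Semidirect Γ G)) :
    ChainComplex (Rep.{max uG uM} k (Semidirect Γ G)) ℕ :=
  ChainComplex.of (fun n => (iterMap M (n + 1)).1) (iterD M) (iterD_comp M)

lemma iterComplex_d (M : Rep.{max uG uM} k (Semidirect Γ G)) (n : ℕ) :
    (iterComplex M).d (n + 1) n = iterD M n :=
  ChainComplex.of_d (fun n => (iterMap M (n + 1)).1) (iterD M) n

/-- Every `G ⋊ Γ`-module has a relatively projective resolution. -/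
def standardResolution (M : Rep.{max uG uM} k (Semidirect Γ G)) : RelativeResolution M where
  complex := iterComplex M
  augmentation := freeOnKerMap (0 : M ⟶ M)
  projective n := isRelativelyProjective_freeOnKer (iterMap M n).2.2
  exact_aug := isProperExact_freeOnKerMap (0 : M ⟶ M)
  exact_zero := by
    rw [iterComplex_d M 0]
    exact isProperExact_freeOnKerMap (freeOnKerMap (0 : M ⟶ M))
  exact_succ n := by
    rw [iterComplex_d M n, iterComplex_d M (n + 1)]
    exact isProperExact_iterD M n

end Existence

end

end EquivariantHomology

/-! The first part follows the classical argument for universal central extensions. A projective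
`Γ`-group lifts along every `Γ`-split surjection, which gives the maps out of
`[P, P]_Γ / [P, R]_Γ`; they are unique because this group is `Γ`-perfect. The only delicate point is
that a `Γ`-section `γ : G → P` of `τ` need not take values in `[P, P]_Γ`: it is corrected by elements
of `R` that depend only on classes in `P / [P, P]_Γ`, on which `Γ` acts trivially
(`exists_section_derivedQuotientMap`).

For the second part let `Q` be a relatively projective resolution of `ℤ` with differentials
`dₙ : Qₙ → Qₙ₋₁`. By right exactness of coinvariants, `H₂` is the kernel of
`(Ker d₁)_{G ⋊ Γ} → (Q₁)_{G ⋊ Γ}`. In the same way `(R ∩ [P, P]_Γ) / [P, R]_Γ` is the kernel of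
`R / [P, R]_Γ → P / [P, P]_Γ`. The two are compared by explicit low-dimensional maps, so that no
second resolution, in particular no resolution in the universe of `Q`, is needed.

* The factor set `c(g, h) = γ(g) γ(h) γ(gh)⁻¹` is a `Γ`-invariant 2-cocycle with values in
  `R / [P, R]_Γ`. Relative projectivity of `Q₀` gives a homomorphism `f : Q₀ → ℤ[G]` over `ℤ`, and
  that of `Q₁` gives a `Γ`-invariant map `u : Q₁ → R / [P, R]_Γ` with
  `u(g z) = u(z) + c(g, f d₁ z)`, which is invariant on `Ker d₁`.
* Let `e` be a `Γ`-invariant element of `Q₀` over `1`. Projectivity of `P` gives a `Γ`-equivariant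
  crossed homomorphism `D : P → Q₁` with `d₁ D(p) = τ(p) e - e`; it maps `R` to `Ker d₁`.

The map `u D` differs from `p ↦ p γ(τ p)⁻¹`, up to a function of `τ p`, by a `Γ`-invariant
homomorphism, which is trivial on `[P, P]_Γ`; therefore `u D(r) = r` for `r` in `R ∩ [P, P]_Γ`
(`IsFactorPrimitive.apply_crossedHom`). Modulo `[P, P]_Γ` the factor set is the coboundary of `γ`,
which shows that `u` maps the kernel in question to `R ∩ [P, P]_Γ`
(`IsFactorPrimitive.exists_mem_derived`). Finally, a homotopy `Q₀ → Q₁` between `x ↦ f(x) e` and the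
identity shows that `u` is injective there (`IsFactorPrimitive.mem_kerAug`). -/

namespace GammaGroup

/-- Commutators do not see central factors. -/
lemma mul_commutator_eq_of_central {X : Type uX} [Group X] {a b : X} (ha : ∀ g, g * a = a * g)
    (hb : ∀ g, g * b = b * g) (x y z : X) :
    a * x * (b * y) * (a * x)⁻¹ * (b * z)⁻¹ = x * y * x⁻¹ * z⁻¹ := by
  calc a * x * (b * y) * (a * x)⁻¹ * (b * z)⁻¹
      = a * (x * b * y * x⁻¹) * a⁻¹ * (z⁻¹ * b⁻¹) := by simp only [mul_inv_rev, mul_assoc]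
    _ = b * (x * y * x⁻¹ * z⁻¹) * b⁻¹ := by
      rw [← ha, mul_inv_cancel_right, hb]; simp only [mul_assoc]
    _ = _ := by rw [← hb, mul_inv_cancel_right]

/-! ### Lifting from projective `Γ`-groups -/

section Lifting

variable {Γ : Type uΓ} [Group Γ] {P : Type uP} [Group P] [MulDistribMulAction Γ P]

/-- A `Γ`-map `f₀` from a projective `Γ`-group `P` to a `Γ`-group can be replaced by a homomorphism of
`Γ`-groups with graph in every subgroup that contains the graph of `f₀`: extend `f₀` to the free
group on `P` and compose with `P → F(P)`. -/
lemma IsProjective.exists_hom (hP : IsProjective Γ P) {X : Type uX} [Group X]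
    [MulDistribMulAction Γ X] (f₀ : P →[Γ] X) :
    ∃ φ : P →*[Γ] X, ∀ W : Subgroup (P × X), (∀ p, (p, f₀ p) ∈ W) → ∀ p, (p, φ p) ∈ W := by
  obtain ⟨s, hs, hs'⟩ := hP
  have key : ∀ (σ : Γ) (w : FreeGroup P),
      FreeGroup.lift f₀ (FreeGroup.map (fun q : P => σ • q) w) = σ • FreeGroup.lift f₀ w := by
    intro σ w
    have : (FreeGroup.lift f₀).comp (FreeGroup.map (fun q : P => σ • q)) =
        (MulDistribMulAction.toMonoidHom X σ).comp (FreeGroup.lift f₀) := by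
      ext p
      simp
    exact DFunLike.congr_fun this w
  refine ⟨{ (FreeGroup.lift f₀).comp s with
    map_smul' := fun σ p => ?_ }, fun W hW p => ?_⟩
  · change FreeGroup.lift f₀ (s (σ • p)) = σ • FreeGroup.lift f₀ (s p)
    rw [hs, key]
  · have h : ∀ w : FreeGroup P, (FreeGroup.lift id w, FreeGroup.lift f₀ w) ∈ W := by
      intro w
      induction w using FreeGroup.induction_on with
      | C1 => exact W.one_mem
      | of x => simpa using hW x
      | inv_of x hx => simpa using W.inv_mem hx
      | mul x y hx hy => simpa using W.mul_mem hx hy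
    have := h (s p)
    rwa [hs'] at this

/-- A projective `Γ`-group lifts along every `Γ`-split surjection of `Γ`-groups. -/
lemma IsProjective.exists_lift (hP : IsProjective Γ P) {G : Type uG} [Group G]
    [MulDistribMulAction Γ G] (τ : P →*[Γ] G) {X : Type uX} [Group X]
    [MulDistribMulAction Γ X] (α : X →*[Γ] G) (hα : ∃ γ : G →[Γ] X, ∀ g, α (γ g) = g) :
    ∃ φ : P →*[Γ] X, ∀ p, α (φ p) = τ p := by
  obtain ⟨γ, hγ⟩ := hα
  obtain ⟨φ, hφ⟩ := hP.exists_hom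
    ({ toFun := fun p => γ (τ p), map_smul' := fun σ p => by simp [map_smul] } : P →[Γ] X)
  refine ⟨φ, fun p => ?_⟩
  exact hφ (MonoidHom.eqLocus (α.toMonoidHom.comp (MonoidHom.snd P X))
    (τ.toMonoidHom.comp (MonoidHom.fst P X))) (fun p => hγ (τ p)) p

end Lifting

/-! ### The `Γ`-abelianization -/

section Derived

variable {Γ : Type uΓ} [Group Γ] {G : Type uG} [Group G] [MulDistribMulAction Γ G]
  {P : Type uP} [Group P] [MulDistribMulAction Γ P]

instance : (derived Γ P).Normal := commutator_normal Γ _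

lemma conj_smul_mem_commutator {H : Subgroup P} (x : P) {y : P} (hy : y ∈ H) (σ : Γ) :
    x * (σ • y) * x⁻¹ * y⁻¹ ∈ commutator Γ H :=
  Subgroup.subset_closure ⟨x, y, hy, σ, rfl⟩

lemma kerCommutator_le_derived (τ : P →*[Γ] G) : kerCommutator τ ≤ derived Γ P :=
  commutator_le_derived Γ _

/-- A homomorphism to an abelian group which is constant on the orbits of `Γ` is trivial on the
`Γ`-commutator subgroup. -/
lemma map_eq_one_of_mem_derived {A : Type uA} [CommGroup A] (f : P →* A)
    (hf : ∀ (σ : Γ) p, f (σ • p) = f p) {p : P} (hp : p ∈ derived Γ P) : f p = 1 := by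
  have h : derived Γ P ≤ f.ker := by
    refine (Subgroup.closure_le _).2 ?_
    rintro _ ⟨x, y, -, σ, rfl⟩
    simp [MonoidHom.mem_ker, hf]
  exact h hp

lemma exists_mem_derived_of_isPerfect (τ : P →*[Γ] G) (hτ : Function.Surjective τ)
    (hG : IsPerfect Γ G) (g : G) : ∃ z ∈ derived Γ P, τ z = g := by
  have h : derived Γ G ≤ (derived Γ P).map τ.toMonoidHom := by
    refine (Subgroup.closure_le _).2 ?_
    rintro _ ⟨x, y, -, σ, rfl⟩
    obtain ⟨x, rfl⟩ := hτ x
    obtain ⟨y, rfl⟩ := hτ y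
    refine ⟨_, conj_smul_mem_commutator x (Subgroup.mem_top y) σ, ?_⟩
    change τ _ = _
    simp [map_smul]
  have hg : g ∈ derived Γ G := by
    rw [show derived Γ G = ⊤ from hG]
    trivial
  obtain ⟨z, hz, hzg⟩ := h hg
  exact ⟨z, hz, hzg⟩

variable (Γ P) in
/-- The `Γ`-abelianization `P / [P, P]_Γ`. -/
abbrev AbQuotient : Type uP := P ⧸ derived Γ P

instance : CommGroup (AbQuotient Γ P) where
  mul_comm a b := by
    induction a using QuotientGroup.induction_on with
    | H a =>
      induction b using QuotientGroup.induction_on with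
      | H b =>
        refine (QuotientGroup.eq.2 ?_ : ((a * b : P) : AbQuotient Γ P) = ((b * a : P) : _))
        have := conj_smul_mem_commutator (Γ := Γ) b⁻¹ (Subgroup.mem_top a⁻¹) 1
        simpa [mul_assoc, derived] using this

lemma AbQuotient.mk_smul (σ : Γ) (p : P) :
    ((σ • p : P) : AbQuotient Γ P) = (p : AbQuotient Γ P) := by
  refine (QuotientGroup.eq.2 ?_).symm
  have := conj_smul_mem_commutator (Γ := Γ) (1 : P) (Subgroup.mem_top p) σ
  have := (commutator_normal Γ (⊤ : Subgroup P)).conj_mem _ this p⁻¹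
  simpa [mul_assoc, derived] using this

end Derived

/-! ### The universal central extension -/

section Universal

variable {Γ : Type uΓ} [Group Γ] {G : Type uG} [Group G] [MulDistribMulAction Γ G]
  {P : Type uP} [Group P] [MulDistribMulAction Γ P] {τ : P →*[Γ] G}

/-- The class in `[P, P]_Γ / [P, R]_Γ` of an element of `[P, P]_Γ`. -/
def DerivedQuotient.mk (τ : P →*[Γ] G) (p : P) (hp : p ∈ derived Γ P) : DerivedQuotient τ :=
  ((⟨p, hp⟩ : derived Γ P) : DerivedQuotient τ)

lemma DerivedQuotient.mk_eq {p q : P} {hp : p ∈ derived Γ P} {hq : q ∈ derived Γ P}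
    (h : p * q⁻¹ ∈ kerCommutator τ) : mk τ p hp = mk τ q hq := by
  refine (QuotientGroup.eq.2 ?_ )
  rw [Subgroup.mem_subgroupOf]
  have := (inferInstance : (kerCommutator τ).Normal).conj_mem _ (inv_mem h) p⁻¹
  simpa [mul_assoc] using this

lemma DerivedQuotient.ind {C : DerivedQuotient τ → Prop} (h : ∀ p hp, C (mk τ p hp)) (u) : C u := by
  induction u using QuotientGroup.induction_on with
  | H z => exact h z.1 z.2

lemma derivedQuotientMap_mk (p : P) (hp : p ∈ derived Γ P) :
    derivedQuotientMap τ (DerivedQuotient.mk τ p hp) = τ p := rfl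

lemma DerivedQuotient.mk_mul (p q : P) (hp : p ∈ derived Γ P) (hq : q ∈ derived Γ P) :
    mk τ p hp * mk τ q hq = mk τ (p * q) (mul_mem hp hq) := rfl

lemma DerivedQuotient.smul_mk (σ : Γ) (p : P) (hp : p ∈ derived Γ P) :
    σ • mk τ p hp = mk τ (σ • p) (smul_mem_derived Γ σ hp) := rfl

/-- Because `G` is `Γ`-perfect, the kernel `R` maps onto `P / [P, P]_Γ`. Correcting the given
`Γ`-section `γ` of `τ` by elements of `R` that depend only on the class of `γ g` in
`P / [P, P]_Γ` moves it into `[P, P]_Γ`. Since `Γ` acts trivially on `P / [P, P]_Γ` and on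
`R / [P, R]_Γ`, the result is a `Γ`-map modulo `[P, R]_Γ`. -/
lemma exists_section_derivedQuotientMap (hτ : ∃ γ : G →[Γ] P, ∀ g, τ (γ g) = g)
    (hG : IsPerfect Γ G) :
    ∃ γ : G →[Γ] DerivedQuotient τ, ∀ g, derivedQuotientMap τ (γ g) = g := by
  obtain ⟨γ, hγ⟩ := hτ
  have hsurj : ∀ a : AbQuotient Γ P, ∃ r : P, r ∈ ker τ ∧ (r : AbQuotient Γ P) = a := by
    intro a
    induction a using QuotientGroup.induction_on with
    | H p =>
      obtain ⟨z, hz, hzp⟩ := exists_mem_derived_of_isPerfect τ (fun g => ⟨γ g, hγ g⟩) hG (τ p)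
      refine ⟨p * z⁻¹, ?_, QuotientGroup.eq.2 ?_⟩
      · simp [mem_ker, hzp]
      · simpa using (inferInstance : (derived Γ P).Normal).conj_mem _ hz 1
  choose t htR ht using hsurj
  have hmem (g : G) : (t (γ g : P))⁻¹ * γ g ∈ derived Γ P := QuotientGroup.eq.1 (ht _)
  refine ⟨⟨fun g => DerivedQuotient.mk τ _ (hmem g), fun σ g => ?_⟩, fun g => ?_⟩
  · rw [DerivedQuotient.smul_mk]
    refine DerivedQuotient.mk_eq ?_
    rw [map_smul γ, AbQuotient.mk_smul]
    have := conj_smul_mem_commutator (Γ := Γ) 1 (htR (γ g : P)) σ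
    have := (inferInstance : (kerCommutator τ).Normal).conj_mem _ this (t (γ g : P))⁻¹
    simpa [mul_assoc, smul_mul', smul_inv'] using this
  · refine (derivedQuotientMap_mk _ _).trans ?_
    rw [map_mul, map_inv, mem_ker.1 (htR _), hγ]
    simp

lemma isCentralExtension_derivedQuotientMap (hτ : ∃ γ : G →[Γ] P, ∀ g, τ (γ g) = g)
    (hG : IsPerfect Γ G) : IsCentralExtension (derivedQuotientMap τ) where
  exists_section := exists_section_derivedQuotientMap hτ hG
  ker_le_center := by
    intro a
    induction a using DerivedQuotient.ind with | h p hp => ?_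
    intro h
    replace h : p ∈ ker τ := h
    refine Subgroup.mem_center_iff.2 fun b => ?_
    induction b using DerivedQuotient.ind with | h q hq => ?_
    refine DerivedQuotient.mk_eq ?_
    have := conj_smul_mem_commutator (Γ := Γ) q h 1
    simpa [mul_assoc, kerCommutator] using this
  smul_eq_of_mem_ker := by
    intro σ a
    induction a using DerivedQuotient.ind with | h p hp => ?_
    intro h
    replace h : p ∈ ker τ := h
    refine DerivedQuotient.mk_eq ?_
    have := conj_smul_mem_commutator (Γ := Γ) 1 h σ
    simpa [mul_assoc, kerCommutator] using this

/-- Modulo `[P, R]_Γ` an element `r c` with `r ∈ R` has the same `Γ`-commutators as `c`, and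
`P = R · [P, P]_Γ`; so the generators of `[P, P]_Γ` can be taken with entries in `[P, P]_Γ`. -/
lemma isPerfect_derivedQuotient (hτ : Function.Surjective τ) (hG : IsPerfect Γ G) :
    IsPerfect Γ (DerivedQuotient τ) := by
  have h : ∀ p (hp : p ∈ derived Γ P),
      DerivedQuotient.mk τ p hp ∈ derived Γ (DerivedQuotient τ) := by
    intro p hp
    have hp' := hp
    induction hp' using Subgroup.closure_induction with
    | mem z hz =>
      obtain ⟨x, y, -, σ, rfl⟩ := hz
      obtain ⟨x', hx', hxx⟩ := exists_mem_derived_of_isPerfect τ hτ hG (τ x)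
      obtain ⟨y', hy', hyy⟩ := exists_mem_derived_of_isPerfect τ hτ hG (τ y)
      have hgen : DerivedQuotient.mk τ (x' * (σ • y') * x'⁻¹ * y'⁻¹)
          (conj_smul_mem_commutator x' (Subgroup.mem_top y') σ) ∈ derived Γ (DerivedQuotient τ) :=
        Subgroup.subset_closure
          ⟨DerivedQuotient.mk τ x' hx', DerivedQuotient.mk τ y' hy', Subgroup.mem_top _, σ, rfl⟩
      convert hgen using 1
      refine DerivedQuotient.mk_eq ?_
      -- compute in `P / [P, R]_Γ`
      let π : P →* P ⧸ kerCommutator τ := QuotientGroup.mk' _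
      have hcomm (r : P) (hr : r ∈ ker τ) (q : P) (δ : Γ) : π q * π (δ • r) = π r * π q := by
        have := conj_smul_mem_commutator (Γ := Γ) q hr δ
        have h1 : π (q * δ • r * q⁻¹ * r⁻¹) = 1 := (QuotientGroup.eq_one_iff _).2 this
        rw [← map_mul, ← map_mul, ← mul_inv_eq_one, ← map_inv, ← map_mul]
        simpa [mul_assoc] using h1
      obtain ⟨r, hr, rfl⟩ : ∃ r ∈ ker τ, x = r * x' :=
        ⟨x * x'⁻¹, by simp [mem_ker, hxx], by simp⟩
      obtain ⟨s, hs, rfl⟩ : ∃ s ∈ ker τ, y = s * y' :=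
        ⟨y * y'⁻¹, by simp [mem_ker, hyy], by simp⟩
      refine (QuotientGroup.eq_one_iff _).1 (?_ : π _ = 1)
      have hr' (q : P ⧸ kerCommutator τ) : q * π r = π r * q := by
        obtain ⟨q, rfl⟩ := QuotientGroup.mk'_surjective _ q
        simpa only [one_smul] using hcomm r hr q 1
      have hs' (q : P ⧸ kerCommutator τ) : q * π s = π s * q := by
        obtain ⟨q, rfl⟩ := QuotientGroup.mk'_surjective _ q
        simpa only [one_smul] using hcomm s hs q 1
      have hsσ : π (σ • s) = π s := by simpa using hcomm s hs 1 σ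
      have e1 : π (r * x' * σ • (s * y') * (r * x')⁻¹ * (s * y')⁻¹) =
          π (x' * σ • y' * x'⁻¹ * y'⁻¹) := by
        simp only [smul_mul', map_mul, map_inv, hsσ]
        exact mul_commutator_eq_of_central hr' hs' _ _ _
      rw [map_mul, e1, map_inv, mul_inv_cancel]
    | one => exact one_mem _
    | mul a b ha hb iha ihb =>
      rw [← DerivedQuotient.mk_mul a b ha hb]
      exact mul_mem (iha ha) (ihb hb)
    | inv a ha iha => exact inv_mem (iha ha)
  exact (Subgroup.eq_top_iff' _).2 (DerivedQuotient.ind h)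

/-- Two homomorphisms over `G` from a `Γ`-perfect group to a central `Γ`-equivariant extension
agree: they differ by central `Γ`-fixed elements, so they agree on `Γ`-commutators. -/
lemma IsPerfect.hom_ext {U : Type uP} [Group U] [MulDistribMulAction Γ U] (hU : IsPerfect Γ U)
    {X : Type uX} [Group X] [MulDistribMulAction Γ X] {α : X →*[Γ] G} (hα : IsCentralExtension α)
    {f f' : U →*[Γ] X} (h : ∀ u, α (f u) = α (f' u)) : f = f' := by
  have hz (u : U) : f' u * (f u)⁻¹ ∈ α.toMonoidHom.ker := by
    change α (f' u * (f u)⁻¹) = 1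
    simp [h]
  have hle : derived Γ U ≤ MonoidHom.eqLocus f.toMonoidHom f'.toMonoidHom := by
    refine (Subgroup.closure_le _).2 ?_
    rintro _ ⟨x, y, -, σ, rfl⟩
    change f _ = f' _
    obtain ⟨a, ha, hax⟩ : ∃ a ∈ α.toMonoidHom.ker, f' x = a * f x := ⟨_, hz x, by simp⟩
    obtain ⟨b, hb, hby⟩ : ∃ b ∈ α.toMonoidHom.ker, f' y = b * f y := ⟨_, hz y, by simp⟩
    have ha' := Subgroup.mem_center_iff.1 (hα.ker_le_center ha)
    have hb' := Subgroup.mem_center_iff.1 (hα.ker_le_center hb)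
    simp only [map_mul, map_smul, map_inv, hax, hby, smul_mul', hα.smul_eq_of_mem_ker σ b hb]
    exact (mul_commutator_eq_of_central ha' hb' _ _ _).symm
  ext u
  exact hle ((show derived Γ U = ⊤ from hU) ▸ Subgroup.mem_top u)

/-- The homomorphisms out of `[P, P]_Γ / [P, R]_Γ` are restrictions of lifts of `τ` to `P`. Such a lift
maps `R` to central `Γ`-invariant elements, so it is trivial on `[P, R]_Γ`. -/
theorem isUniversalCentralExtension_derivedQuotientMap (hτ : IsProjectivePresentation τ)
    (hG : IsPerfect Γ G) :
    IsUniversalCentralExtension.{uΓ, uG, uP, uX} (derivedQuotientMap τ) := by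
  refine ⟨isCentralExtension_derivedQuotientMap hτ.exists_section hG, fun X _ _ α hα => ?_⟩
  obtain ⟨φ, hφ⟩ := hτ.projective.exists_lift τ α hα.exists_section
  have hker : kerCommutator τ ≤ φ.toMonoidHom.ker := by
    refine (Subgroup.closure_le _).2 ?_
    rintro _ ⟨x, y, hy, σ, rfl⟩
    have hy' : φ y ∈ α.toMonoidHom.ker := (hφ y).trans hy
    change φ _ = 1
    rw [map_mul, map_mul, map_mul, map_smul, hα.smul_eq_of_mem_ker σ _ hy',
      Subgroup.mem_center_iff.1 (hα.ker_le_center hy'), map_inv, map_inv]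
    simp
  let f : DerivedQuotient τ →*[Γ] X :=
    { QuotientGroup.lift _ (φ.toMonoidHom.comp (derived Γ P).subtype)
        (fun z hz => hker (x := (z : P)) hz) with
      map_smul' := fun σ u => by
        induction u using DerivedQuotient.ind with | h p hp => ?_
        exact map_smul φ σ p }
  have hf : ∀ u, α (f u) = derivedQuotientMap τ u := DerivedQuotient.ind fun p _ => hφ p
  have hsurj : Function.Surjective τ := fun g =>
    let ⟨γ, hγ⟩ := hτ.exists_section
    ⟨γ g, hγ g⟩
  exact ⟨f, hf, fun f' hf' => (isPerfect_derivedQuotient hsurj hG).hom_ext hα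
    fun u => (hf' u).trans (hf u).symm⟩

end Universal

/-! ### The factor set of a presentation -/

section KernelQuotient

variable {Γ : Type uΓ} [Group Γ] {G : Type uG} [Group G] [MulDistribMulAction Γ G]
  {P : Type uP} [Group P] [MulDistribMulAction Γ P]

/-- The group `R / [P, R]_Γ`, where `R` is the kernel of `τ : P → G`. It is the group of
coinvariants of `R` under conjugation by `P` and the action of `Γ`; in particular it is abelian. -/
abbrev KerQuotient (τ : P →*[Γ] G) : Type uP :=
  ker τ ⧸ (kerCommutator τ).subgroupOf (ker τ)

variable {τ : P →*[Γ] G}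

lemma conj_smul_mem_ker (x : P) (σ : Γ) {y : P} (hy : y ∈ ker τ) :
    x * (σ • y) * x⁻¹ ∈ ker τ := by
  rw [mem_ker] at hy ⊢
  simp [map_smul, hy]

lemma KerQuotient.mk_conj_smul (x : P) (σ : Γ) (y : ker τ) :
    ((⟨x * (σ • (y : P)) * x⁻¹, conj_smul_mem_ker x σ y.2⟩ : ker τ) : KerQuotient τ) = y := by
  refine (QuotientGroup.eq.2 ?_).symm
  rw [Subgroup.mem_subgroupOf]
  have := conj_smul_mem_commutator (Γ := Γ) x y.2 σ
  have := (inferInstance : (kerCommutator τ).Normal).conj_mem _ this (y : P)⁻¹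
  simpa [mul_assoc] using this

instance : CommGroup (KerQuotient τ) where
  mul_comm a b := by
    induction a using QuotientGroup.induction_on with
    | H a =>
      induction b using QuotientGroup.induction_on with
      | H b =>
        have h : ((b * a * b⁻¹ : ker τ) : KerQuotient τ) = a := by
          have := KerQuotient.mk_conj_smul (b : P) (1 : Γ) a
          simp only [one_smul] at this
          exact this
        calc (a : KerQuotient τ) * b = ((b * a * b⁻¹ : ker τ) : KerQuotient τ) * b := by rw [h]
          _ = b * a := by rw [← QuotientGroup.mk_mul, inv_mul_cancel_right, QuotientGroup.mk_mul]

variable (γ : G →[Γ] P) (hγ : ∀ g, τ (γ g) = g)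

include hγ in
lemma factorSet_mem_ker (g h : G) : γ g * γ h * (γ (g * h))⁻¹ ∈ ker τ := by
  simp [mem_ker, hγ]

/-- The factor set of the extension `R / [P, R]_Γ → P / [P, R]_Γ → G` with respect to the section
`γ`. -/
def factorSet (g h : G) : Additive (KerQuotient τ) :=
  Additive.ofMul ((⟨_, factorSet_mem_ker γ hγ g h⟩ : ker τ) : KerQuotient τ)

/-- Conjugation by `γ g` is trivial on `R / [P, R]_Γ`, so the coefficients are trivial. -/
lemma factorSet_cocycle (g h k : G) :
    factorSet γ hγ g h + factorSet γ hγ (g * h) k =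
      factorSet γ hγ h k + factorSet γ hγ g (h * k) := by
  apply Additive.toMul.injective
  have h1 := KerQuotient.mk_conj_smul (τ := τ) (γ g) (1 : Γ) ⟨_, factorSet_mem_ker γ hγ h k⟩
  simp only [factorSet, toMul_add, toMul_ofMul]
  rw [← h1, ← QuotientGroup.mk_mul, ← QuotientGroup.mk_mul]
  congr 1
  ext
  simp [mul_assoc]

lemma factorSet_smul (σ : Γ) (g h : G) :
    factorSet γ hγ (σ • g) (σ • h) = factorSet γ hγ g h := by
  apply Additive.toMul.injective
  have h1 := KerQuotient.mk_conj_smul (τ := τ) 1 σ ⟨_, factorSet_mem_ker γ hγ g h⟩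
  simp only [factorSet, toMul_ofMul]
  rw [← h1]
  congr 1
  ext
  simp [← smul_mul', ← smul_inv', map_smul]

end KernelQuotient

end GammaGroup

namespace EquivariantHomology

open GammaGroup Representation

noncomputable section

/-! ### The augmentation of the group ring -/

section Augmentation

/-- The augmentation `ℤ[G] → ℤ`. -/
def aug (G : Type uG) : (G →₀ ℤ) →ₗ[ℤ] ℤ := Finsupp.linearCombination ℤ fun _ => 1

lemma aug_single {G : Type uG} (g : G) (n : ℤ) : aug G (Finsupp.single g n) = n := by simp [aug]

end Augmentation

variable {Γ : Type uΓ} [Group Γ] {G : Type uG} [Group G] [MulDistribMulAction Γ G]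
  {P : Type uP} [Group P] [MulDistribMulAction Γ P] {τ : P →*[Γ] G}

/-! ### Crossed homomorphisms on projective `Γ`-groups -/

section CrossedHom

variable {k : Type uA} [CommRing k] {M : Type uM} [AddCommGroup M] [Module k M]
  (ρ : Representation k (Semidirect Γ G) M)

/-- The crossed homomorphism on a free group with prescribed values on the generators. -/
lemma exists_crossedHom_freeGroup {X : Type uX} (θ : FreeGroup X →* G) (f : X → M) :
    ∃ D : FreeGroup X → M, (∀ v w, D (v * w) = D v + ρ (.inl (θ v)) (D w)) ∧
      ∀ x, D (.of x) = f x := by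
  -- the affine transformation `m ↦ θ(x) m + f(x)`
  let A : FreeGroup X →* Equiv.Perm M := FreeGroup.lift fun x =>
    { toFun := fun m => ρ (.inl (θ (.of x))) m + f x
      invFun := fun m => ρ (.inl (θ (.of x))⁻¹) (m - f x)
      left_inv := fun m => by
        simp only [add_sub_cancel_right, map_inv, Representation.inv_self_apply]
      right_inv := fun m => by
        simp only [map_inv, Representation.self_inv_apply, sub_add_cancel] }
  have hA : ∀ w m, A w m = ρ (.inl (θ w)) m + A w 0 := by
    intro w
    induction w using FreeGroup.induction_on with
    | C1 => intro m; simp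
    | of x => intro m; simp [A]
    | inv_of x hx =>
      intro m
      apply (A (.of x)).injective
      rw [hx (_ + _), map_add, ← Module.End.mul_apply, ← map_mul, ← map_mul, ← map_mul,
        mul_inv_cancel, map_one, map_one, map_one, Module.End.one_apply, add_assoc, ← hx,
        ← Equiv.Perm.mul_apply, ← Equiv.Perm.mul_apply, ← map_mul, mul_inv_cancel, map_one]
      simp
    | mul x y hx hy =>
      intro m
      rw [map_mul, Equiv.Perm.mul_apply, Equiv.Perm.mul_apply, hy, hx, hx (A y 0)]
      simp [add_assoc]
  refine ⟨fun w => A w 0, fun v w => ?_, fun x => by simp [A]⟩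
  dsimp only
  rw [map_mul, Equiv.Perm.mul_apply, hA, add_comm]

variable {ρ} in
lemma crossedHom_freeGroup_ext {X : Type uX} {θ : FreeGroup X →* G} {D D' : FreeGroup X → M}
    (hD : ∀ v w, D (v * w) = D v + ρ (.inl (θ v)) (D w))
    (hD' : ∀ v w, D' (v * w) = D' v + ρ (.inl (θ v)) (D' w))
    (h : ∀ x, D (.of x) = D' (.of x)) : D = D' := by
  have one {E : FreeGroup X → M} (hE : ∀ v w, E (v * w) = E v + ρ (.inl (θ v)) (E w)) :
      E 1 = 0 := by simpa using hE 1 1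
  have inv {E : FreeGroup X → M} (hE : ∀ v w, E (v * w) = E v + ρ (.inl (θ v)) (E w)) (v) :
      E v⁻¹ = - ρ (.inl (θ v⁻¹)) (E v) := by
    have := hE v⁻¹ v
    rw [inv_mul_cancel, one hE] at this
    exact eq_neg_of_add_eq_zero_left this.symm
  funext w
  induction w using FreeGroup.induction_on with
  | C1 => rw [one hD, one hD']
  | of x => exact h x
  | inv_of x hx => rw [inv hD, inv hD', hx]
  | mul x y hx hy => rw [hD, hD', hx, hy]

lemma inr_inl (σ : Γ) (g : G) (m : M) :
    ρ (.inr σ) (ρ (.inl g) m) = ρ (.inl (σ • g)) (ρ (.inr σ) m) := by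
  rw [← Module.End.mul_apply, ← Module.End.mul_apply, ← map_mul, ← map_mul]
  congr 2
  ext <;> simp

/-- On a projective `Γ`-group `P` over `G` there are `Γ`-equivariant crossed homomorphisms `D` with
values in a `G ⋊ Γ`-module, lifting a given principal one. -/
lemma exists_crossedHom (hP : IsProjective Γ P) (τ : P →*[Γ] G) {N : Type uX} [AddCommGroup N]
    [Module k N] (ρN : Representation k (Semidirect Γ G) N) (d : ρ.IntertwiningMap ρN) (e : N)
    (f : P → M) (hf : ∀ (σ : Γ) p, f (σ • p) = ρ (.inr σ) (f p))
    (hdf : ∀ p, d (f p) = ρN (.inl (τ p)) e - e) :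
    ∃ D : P → M, (∀ p q, D (p * q) = D p + ρ (.inl (τ p)) (D q)) ∧
      (∀ (σ : Γ) p, D (σ • p) = ρ (.inr σ) (D p)) ∧
      ∀ p, d (D p) = ρN (.inl (τ p)) e - e := by
  obtain ⟨s, hs, hs'⟩ := hP
  let π : FreeGroup P →* P := FreeGroup.lift id
  obtain ⟨D, hD, hDf⟩ := exists_crossedHom_freeGroup ρ (τ.toMonoidHom.comp π) f
  replace hD : ∀ v w, D (v * w) = D v + ρ (.inl (τ (π v))) (D w) := hD
  have hDσ (σ : Γ) : (fun w => ρ (.inr σ⁻¹) (D (FreeGroup.map (fun q : P => σ • q) w))) = D := by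
    have hπ (w) : π (FreeGroup.map (fun q : P => σ • q) w) = σ • π w := by
      have : π.comp (FreeGroup.map (fun q : P => σ • q)) =
        (MulDistribMulAction.toMonoidHom P σ).comp π := by
        ext p
        simp [π]
      exact DFunLike.congr_fun this w
    refine crossedHom_freeGroup_ext (ρ := ρ) (θ := τ.toMonoidHom.comp π) (fun v w => ?_) hD
      fun x => ?_
    · simp only [map_mul, hD, map_add, hπ, inr_inl]
      simp [map_smul]
    · simp [hDf, hf]
  have hdD : (fun w => d (D w)) = fun w => ρN (.inl (τ (π w))) e - e := by
    refine crossedHom_freeGroup_ext (ρ := ρN) (θ := τ.toMonoidHom.comp π) (fun v w => ?_)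
      (fun v w => ?_) fun x => ?_
    · simp [hD, IntertwiningMap.isIntertwining]
    · simp 
    · simp [hDf, hdf, π]
  refine ⟨fun p => D (s p), fun p q => ?_, fun σ p => ?_, fun p => ?_⟩
  · beta_reduce
    rw [map_mul, hD, show π (s p) = p from hs' p]
  · have := congrFun (hDσ σ) (s p)
    dsimp only at this ⊢
    rw [hs, ← this, map_inv, Representation.self_inv_apply]
  · rw [congrFun hdD (s p), show π (s p) = p from hs' p]

end CrossedHom

/-! ### Lifting from relatively projective modules -/

section Lifting

variable {k : Type} [CommRing k]

/-- Let `b` be a 1-cocycle of `G`, invariant under `Γ`, with values in the maps from a relatively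
projective module `M` to `V`. There is a `Γ`-equivariant `f : M → V` whose deviation from
`G`-equivariance is `b`; on a relatively free module, it is given by `f(g s) = g f₀(s) + b_g(s)` on
the basis. The last clause transfers to `f` any linear relation that holds for these values; it is
used to make `f` a lift of a given homomorphism. -/
lemma exists_twisted_hom {M : Rep.{uM} k (Semidirect Γ G)} (hM : IsRelativelyProjective M)
    {V : Type uX} [AddCommGroup V] [Module k V] (ρ : Representation k (Semidirect Γ G) V)
    (b : G → M →ₗ[k] V)
    (hb : ∀ g h x, b (g * h) x = ρ (.inl g) (b h x) + b g (M.ρ (.inl h) x))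
    (hbσ : ∀ (σ : Γ) g x, ρ (.inr σ) (b g x) = b (σ • g) (M.ρ (.inr σ) x))
    (f₀ : M → V) (hf₀ : ∀ (σ : Γ) x, f₀ (M.ρ (.inr σ) x) = ρ (.inr σ) (f₀ x)) :
    ∃ f : M →ₗ[k] V, (∀ g x, f (M.ρ (.inl g) x) = ρ (.inl g) (f x) + b g x) ∧
      (∀ (σ : Γ) x, f (M.ρ (.inr σ) x) = ρ (.inr σ) (f x)) ∧
      ∀ W : Submodule k (M × V),
        (∀ g x, (M.ρ (.inl g) x, ρ (.inl g) (f₀ x) + b g x) ∈ W) → ∀ x, (x, f x) ∈ W := by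
  obtain ⟨F, i, r, ⟨S, hS, hli, hsp⟩, hir⟩ := hM
  let B : Module.Basis (G × S) k F := Module.Basis.mk hli hsp.ge
  have hB (g : G) (s : S) : B (g, s) = F.ρ (.inl g) (s : F) := Module.Basis.mk_apply hli hsp.ge _
  let f : F →ₗ[k] V := B.constr k fun x => ρ (.inl x.1) (f₀ (r.hom x.2)) + b x.1 (r.hom x.2)
  have hf (g : G) (s : F) (hs : s ∈ S) :
      f (F.ρ (.inl g) s) = ρ (.inl g) (f₀ (r.hom s)) + b g (r.hom s) := by
    rw [← hB g ⟨s, hs⟩]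
    exact B.constr_basis k _ _
  have hri (x : M) : r.hom (i.hom x) = x := congr($hir x)
  have hfl (g : G) (x : F) : f (F.ρ (.inl g) x) = ρ (.inl g) (f x) + b g (r.hom x) := by
    have : f ∘ₗ F.ρ (.inl g) = ρ (.inl g) ∘ₗ f + b g ∘ₗ r.hom.toLinearMap := by
      refine B.ext fun ⟨h, s⟩ => ?_
      simp only [LinearMap.comp_apply, LinearMap.add_apply, hB]
      rw [← Module.End.mul_apply, ← map_mul, ← map_mul, hf _ _ s.2, hf _ _ s.2, hb, map_add,
        ← Module.End.mul_apply, ← map_mul, ← map_mul, add_assoc]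
      congr 2
      exact congrArg _ (Rep.hom_comm_apply r _ _).symm
    exact congr($this x)
  have hfr (σ : Γ) (x : F) : f (F.ρ (.inr σ) x) = ρ (.inr σ) (f x) := by
    have : f ∘ₗ F.ρ (.inr σ) = ρ (.inr σ) ∘ₗ f := by
      refine B.ext fun ⟨h, s⟩ => ?_
      simp only [LinearMap.comp_apply, hB]
      rw [inr_inl, hf _ _ s.2, hf _ _ (hS σ s s.2), Rep.hom_comm_apply, hf₀, map_add, hbσ, inr_inl]
    exact congr($this x)
  refine ⟨f ∘ₗ i.hom.toLinearMap, fun g x => ?_, fun σ x => ?_, fun W hW x => ?_⟩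
  · change f (i.hom _) = ρ _ (f (i.hom _)) + _
    rw [Rep.hom_comm_apply, hfl, hri]
  · change f (i.hom _) = ρ _ (f (i.hom _))
    rw [Rep.hom_comm_apply, hfr]
  · have h : (⊤ : Submodule k F) ≤ W.comap (r.hom.toLinearMap.prod f) := by
      rw [← B.span_eq, Submodule.span_le]
      rintro _ ⟨⟨g, s⟩, rfl⟩
      change (r.hom _, f _) ∈ W
      rw [hB, hf _ _ s.2, Rep.hom_comm_apply]
      exact hW g _
    have := h (Submodule.mem_top (x := i.hom x))
    change (r.hom _, f _) ∈ W at this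
    rw [hri] at this
    exact this

/-- A homomorphism `φ` from a relatively projective module lifts along `β` as soon as it has a lift
`f₀` that is a `Γ`-map of sets. -/
lemma exists_lift {M : Rep.{uM} k (Semidirect Γ G)} (hM : IsRelativelyProjective M)
    {V : Type uX} [AddCommGroup V] [Module k V] {ρ : Representation k (Semidirect Γ G) V}
    {N : Type uA} [AddCommGroup N] [Module k N] {ρN : Representation k (Semidirect Γ G) N}
    (β : ρ.IntertwiningMap ρN) (φ : M.ρ.IntertwiningMap ρN)
    (f₀ : M → V) (hf₀ : ∀ (σ : Γ) x, f₀ (M.ρ (.inr σ) x) = ρ (.inr σ) (f₀ x))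
    (hβ : ∀ x, β (f₀ x) = φ x) :
    ∃ f : M.ρ.IntertwiningMap ρ, ∀ x, β (f x) = φ x := by
  obtain ⟨f, hfl, hfr, hf⟩ := exists_twisted_hom hM ρ 0 (by simp) (by simp) f₀ hf₀
  refine ⟨LinearMap.intertwiningMap_of_isIntertwiningMap _ _ f fun t x => ?_, fun x => ?_⟩
  · rw [← SemidirectProduct.inl_left_mul_inr_right t, map_mul, Module.End.mul_apply, hfl, hfr,
      map_mul, Module.End.mul_apply]
    simp
  · exact hf (LinearMap.eqLocus (β.toLinearMap ∘ₗ LinearMap.snd k M V)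
      (φ.toLinearMap ∘ₗ LinearMap.fst k M V))
      (fun g x => by simp [IntertwiningMap.isIntertwining, hβ]) x

end Lifting

/-! ### The group ring -/

section GroupRing

variable (Γ G) in
/-- The group ring `ℤ[G]` as a `G ⋊ Γ`-module: `(g, σ)` sends `h` to `g · ᵟh`. -/
def groupRing : Representation ℤ (Semidirect Γ G) (G →₀ ℤ) where
  toFun t := Finsupp.lmapDomain ℤ ℤ fun h => t.left * t.right • h
  map_one' := by
    ext
    simp
  map_mul' t t' := by
    ext
    simp [mul_assoc, mul_smul]

lemma groupRing_single (t : Semidirect Γ G) (h : G) (n : ℤ) :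
    groupRing Γ G t (Finsupp.single h n) = Finsupp.single (t.left * t.right • h) n :=
  Finsupp.mapDomain_single

end GroupRing

/-! ### The factor set on the group ring -/

section FactorSet

lemma aug_groupRing (t : Semidirect Γ G) (x : G →₀ ℤ) : aug G (groupRing Γ G t x) = aug G x := by
  induction x using Finsupp.induction_linear with
  | zero => simp
  | add x y hx hy => simp only [map_add, hx, hy]
  | single h n => rw [groupRing_single, aug_single, aug_single]

variable (γ : G →[Γ] P) (hγ : ∀ g, τ (γ g) = g)

/-- The factor set extended linearly in the second variable to `ℤ[G]`. -/
def factorMap (g : G) : (G →₀ ℤ) →ₗ[ℤ] Additive (KerQuotient τ) :=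
  Finsupp.linearCombination ℤ (factorSet γ hγ g)

lemma factorMap_single (g h : G) (n : ℤ) :
    factorMap γ hγ g (Finsupp.single h n) = n • factorSet γ hγ g h := by
  simp [factorMap]

/-- The cocycle identity. On the augmentation ideal its last term vanishes, so that `g ↦ factorMap g`
is a 1-cocycle there. -/
lemma factorMap_mul (g h : G) (x : G →₀ ℤ) :
    factorMap γ hγ (g * h) x = factorMap γ hγ h x + factorMap γ hγ g (groupRing Γ G (.inl h) x) -
      aug G x • factorSet γ hγ g h := by
  induction x using Finsupp.induction_linear with
  | zero => simp
  | add x y hx hy => simp only [map_add, hx, hy, add_smul]; abel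
  | single k n =>
    rw [groupRing_single, aug_single]
    simp only [factorMap_single, ← smul_add, ← smul_sub]
    congr 1
    rw [eq_sub_iff_add_eq, add_comm, factorSet_cocycle]
    simp

lemma factorMap_smul (σ : Γ) (g : G) (x : G →₀ ℤ) :
    factorMap γ hγ (σ • g) (groupRing Γ G (.inr σ) x) = factorMap γ hγ g x := by
  induction x using Finsupp.induction_linear with
  | zero => simp
  | add x y hx hy => simp only [map_add, hx, hy]
  | single k n => simp [groupRing_single, factorMap_single, factorSet_smul]

end FactorSet

/-! ### Maps vanishing in the coinvariants -/

section Coinvariants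

variable {Q : Type uM} [AddCommGroup Q] [Module ℤ Q] {ρ : Representation ℤ (Semidirect Γ G) Q}

lemma map_eq_zero_of_mem_ker {A : Type uA} [AddCommGroup A] (s : Q →+ A)
    (hl : ∀ g z, s (ρ (.inl g) z) = s z) (hr : ∀ (σ : Γ) z, s (ρ (.inr σ) z) = s z) {z : Q}
    (hz : z ∈ Coinvariants.ker ρ) : s z = 0 := by
  induction hz using Submodule.span_induction with
  | mem z hz =>
    obtain ⟨⟨t, z⟩, rfl⟩ := hz
    rw [map_sub, ← SemidirectProduct.inl_left_mul_inr_right t, map_mul, Module.End.mul_apply, hl,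
      hr, sub_self]
  | zero => exact map_zero s
  | add x y _ _ hx hy => rw [map_add, hx, hy, add_zero]
  | smul n x _ hx =>
    have := map_intCast_smul s ℤ ℤ n x
    rw [Int.cast_id] at this
    rw [this, hx, smul_zero]

end Coinvariants

/-! ### Identities for crossed homomorphisms -/

section CrossedHom

variable {Q : Type uM} [AddCommGroup Q] [Module ℤ Q] {ρ : Representation ℤ (Semidirect Γ G) Q}
  {D : P → Q} (hD : ∀ p q, D (p * q) = D p + ρ (.inl (τ p)) (D q))

include hD

/-- For `r = p q⁻¹` in the kernel of `τ` the twist in `D` disappears. -/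
lemma crossedHom_mul_inv {p q : P} (h : τ p = τ q) : D (p * q⁻¹) = D p - D q := by
  have := hD (p * q⁻¹) q
  rw [inv_mul_cancel_right, map_mul, map_inv, h, mul_inv_cancel] at this
  rw [this]
  simp

lemma crossedHom_conj (p : P) {r : P} (hr : r ∈ ker τ) :
    D (p * r * p⁻¹) = ρ (.inl (τ p)) (D r) := by
  rw [crossedHom_mul_inv hD, hD, add_sub_cancel_left]
  rw [map_mul, mem_ker.1 hr, mul_one]

/-- Followed by the projection to the coinvariants, a crossed homomorphism becomes an invariant
homomorphism, so it kills the `Γ`-commutator subgroup. -/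
lemma crossedHom_mem_ker (hDσ : ∀ (σ : Γ) p, D (σ • p) = ρ (.inr σ) (D p)) {p : P}
    (hp : p ∈ derived Γ P) : D p ∈ Coinvariants.ker ρ := by
  let f : P →* Multiplicative (Coinvariants ρ) :=
    MonoidHom.mk' (fun p => .ofAdd (Coinvariants.mk ρ (D p))) fun p q => by
      rw [hD, map_add, Coinvariants.mk_self_apply]
      rfl
  have := map_eq_one_of_mem_derived f (fun σ p => by
    change Multiplicative.ofAdd _ = Multiplicative.ofAdd _
    rw [hDσ, Coinvariants.mk_self_apply]) hp
  exact (Coinvariants.mk_eq_zero ρ).1 this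

end CrossedHom

/-! ### Comparison of `Ker d` with the kernel of the presentation -/

section Comparison

variable (γ : G →[Γ] P) (hγ : ∀ g, τ (γ g) = g)
  {Q₁ : Type uM} [AddCommGroup Q₁] [Module ℤ Q₁] {ρ₁ : Representation ℤ (Semidirect Γ G) Q₁}
  {Q₀ : Type uM} [AddCommGroup Q₀] [Module ℤ Q₀] {ρ₀ : Representation ℤ (Semidirect Γ G) Q₀}
  (d : ρ₁.IntertwiningMap ρ₀) (f : ρ₀.IntertwiningMap (groupRing Γ G))

/-- The subgroup of `Q₁` generated by the elements `t y - y` with `y` in the kernel of `d`: the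
quotient of `Ker d` by it is the group of `G ⋊ Γ`-coinvariants of `Ker d`. -/
def kerAug : Submodule ℤ Q₁ :=
  Submodule.span ℤ {z | ∃ t y, d y = 0 ∧ z = ρ₁ t y - y}

variable {d} in
lemma mkQ_kerAug (t : Semidirect Γ G) {y : Q₁} (hy : d y = 0) :
    (kerAug d).mkQ (ρ₁ t y) = (kerAug d).mkQ y := by
  rw [← sub_eq_zero, ← map_sub, Submodule.mkQ_apply, Submodule.Quotient.mk_eq_zero]
  exact Submodule.subset_span ⟨t, y, hy, rfl⟩

/-- A `Γ`-invariant map `u : Q₁ → R / [P, R]_Γ` whose deviation from `G`-invariance is given by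
the factor set of `τ`. It restricts to an invariant map on the kernel of `d : Q₁ → Q₀`. -/
structure IsFactorPrimitive (u : Q₁ →ₗ[ℤ] Additive (KerQuotient τ)) : Prop where
  inl : ∀ g z, u (ρ₁ (.inl g) z) = u z + factorMap γ hγ g (f (d z))
  inr : ∀ (σ : Γ) z, u (ρ₁ (.inr σ) z) = u z

variable {γ hγ d f} {u : Q₁ →ₗ[ℤ] Additive (KerQuotient τ)}
  (hu : IsFactorPrimitive γ hγ d f u)

include hu

/-- On `R ∩ [P, P]_Γ` the composite of `u` with a crossed homomorphism `D : P → Q₁` is the identity.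
Both `u D` and `v(p) = p γ(τ p)⁻¹` are additive up to the factor set, the former with a further
coboundary which comes from the choice of `e`. So they differ, up to a function of `τ p`, by a
`Γ`-invariant homomorphism. -/
lemma IsFactorPrimitive.apply_crossedHom {D : P → Q₁}
    (hD : ∀ p q, D (p * q) = D p + ρ₁ (.inl (τ p)) (D q))
    (hDσ : ∀ (σ : Γ) p, D (σ • p) = ρ₁ (.inr σ) (D p)) {e : Q₀}
    (hdD : ∀ p, d (D p) = ρ₀ (.inl (τ p)) e - e) (he : ∀ σ : Γ, ρ₀ (.inr σ) e = e)
    (hfe : aug G (f e) = 1) {r : P} (hr : r ∈ ker τ) (hr' : r ∈ derived Γ P) :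
    u (D r) = Additive.ofMul ((⟨r, hr⟩ : ker τ) : KerQuotient τ) := by
  -- `R`-component of `p` with respect to the section `γ`
  have hv (p : P) : p * (γ (τ p))⁻¹ ∈ ker τ := by simp [mem_ker, hγ]
  let v (p : P) : Additive (KerQuotient τ) :=
    Additive.ofMul ((⟨_, hv p⟩ : ker τ) : KerQuotient τ)
  have v_mul (p q : P) : v (p * q) = v p + v q + factorSet γ hγ (τ p) (τ q) := by
    apply Additive.toMul.injective
    have h := KerQuotient.mk_conj_smul (τ := τ) (γ (τ p)) (1 : Γ) ⟨_, hv q⟩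
    simp only [v, factorSet, toMul_add, toMul_ofMul]
    rw [← h, ← QuotientGroup.mk_mul, ← QuotientGroup.mk_mul]
    congr 1
    ext
    simp [mul_assoc]
  have v_smul (σ : Γ) (p : P) : v (σ • p) = v p := by
    apply Additive.toMul.injective
    have h := KerQuotient.mk_conj_smul (τ := τ) 1 σ ⟨_, hv p⟩
    simp only [v, toMul_ofMul]
    rw [← h]
    congr 1
    ext
    simp [smul_mul', smul_inv', map_smul]
  let m (g : G) : Additive (KerQuotient τ) := factorMap γ hγ g (f e)
  have m_smul (σ : Γ) (g : G) : m (σ • g) = m g := by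
    have := factorMap_smul γ hγ σ g (f e)
    rwa [← IntertwiningMap.isIntertwining, he] at this
  have uD_mul (p q : P) : u (D (p * q)) =
      u (D p) + u (D q) + (m (τ p * τ q) - m (τ p) - m (τ q) + factorSet γ hγ (τ p) (τ q)) := by
    have h := factorMap_mul γ hγ (τ p) (τ q) (f e)
    rw [hfe, one_smul] at h
    rw [hD, map_add, hu.inl, hdD, map_sub, map_sub, IntertwiningMap.isIntertwining, add_assoc]
    congr 2
    simp only [m]
    rw [h]
    abel
  let δ : P →* KerQuotient τ :=
    MonoidHom.mk' (fun p => Additive.toMul (u (D p) - v p - m (τ p))) fun p q => by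
      rw [← toMul_add, uD_mul, v_mul, map_mul]
      congr 1
      abel
  have hδ := map_eq_one_of_mem_derived δ (fun σ p => by
    change Additive.toMul _ = Additive.toMul _
    rw [hDσ, hu.inr, v_smul, map_smul, m_smul]) hr'
  have hδ' : u (D r) - v r - m (τ r) = 0 := hδ
  -- `γ` need not be normalized: `m 1` is the class of `γ 1`, which cancels the one in `v r`
  have hγ1 : γ 1 ∈ ker τ := hγ 1
  have m_one : m 1 = Additive.ofMul ((⟨γ 1, hγ1⟩ : ker τ) : KerQuotient τ) := by
    have h (x : G →₀ ℤ) : factorMap γ hγ 1 x =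
        aug G x • Additive.ofMul ((⟨γ 1, hγ1⟩ : ker τ) : KerQuotient τ) := by
      induction x using Finsupp.induction_linear with
      | zero => simp
      | add x y hx hy => simp only [map_add, hx, hy, add_smul]
      | single k n =>
        rw [factorMap_single, aug_single]
        congr 1
        simp only [factorSet]
        congr 2
        ext
        simp
    simp only [m, h, hfe, one_smul]
  rw [sub_sub, sub_eq_zero] at hδ'
  rw [hδ', mem_ker.1 hr, m_one]
  apply Additive.toMul.injective
  simp only [v, toMul_add, toMul_ofMul]
  rw [← QuotientGroup.mk_mul]
  congr 1
  ext
  simp [mem_ker.1 hr]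

/-- On the elements of `Ker d` that vanish in the coinvariants of `Q₁`, the map `u` takes values in
`R ∩ [P, P]_Γ`. In `P / [P, P]_Γ` the factor set is the coboundary of `w(g) = γ(g)`, so that
`u + w f d` is an invariant map from `Q₁` to this group. -/
lemma IsFactorPrimitive.exists_mem_derived (haug : ∀ z, aug G (f (d z)) = 0) {z : Q₁}
    (hz : z ∈ Coinvariants.ker ρ₁)
    (hdz : d z = 0) : ∃ r : ker τ, (r : P) ∈ derived Γ P ∧
      u z = Additive.ofMul (r : KerQuotient τ) := by
  let q : KerQuotient τ →* AbQuotient Γ P :=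
    QuotientGroup.lift _ ((QuotientGroup.mk' (derived Γ P)).comp (ker τ).subtype) fun r hr =>
      (QuotientGroup.eq_one_iff _).2 (kerCommutator_le_derived τ hr)
  have hq (r : ker τ) : q (r : KerQuotient τ) = ((r : P) : AbQuotient Γ P) := rfl
  let w : (G →₀ ℤ) →ₗ[ℤ] Additive (AbQuotient Γ P) :=
    Finsupp.linearCombination ℤ fun g => Additive.ofMul (γ g : AbQuotient Γ P)
  have hw (g : G) (n : ℤ) : w (.single g n) = n • Additive.ofMul (γ g : AbQuotient Γ P) := by
    simp [w]
  have hwr (σ : Γ) (x) : w (groupRing Γ G (.inr σ) x) = w x := by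
    induction x using Finsupp.induction_linear with
    | zero => simp
    | add x y hx hy => simp only [map_add, hx, hy]
    | single k n => simp [groupRing_single, hw, map_smul, AbQuotient.mk_smul]
  have hwl (g : G) (x) : q.toAdditive (factorMap γ hγ g x) =
      aug G x • Additive.ofMul (γ g : AbQuotient Γ P) + w x - w (groupRing Γ G (.inl g) x) := by
    induction x using Finsupp.induction_linear with
    | zero => simp
    | add x y hx hy => simp only [map_add, hx, hy, add_smul]; abel
    | single k n =>
      rw [groupRing_single, factorMap_single, aug_single, hw, hw, map_zsmul, ← smul_add, ← smul_sub]
      congr 1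
      simp [factorSet, hq, sub_eq_add_neg]
  let s : Q₁ →+ Additive (AbQuotient Γ P) :=
    q.toAdditive.comp u.toAddMonoidHom + (w ∘ₗ f.toLinearMap ∘ₗ d.toLinearMap).toAddMonoidHom
  have hs (z : Q₁) : s z = q.toAdditive (u z) + w (f (d z)) := rfl
  have h0 : s z = 0 := by
    refine map_eq_zero_of_mem_ker s (fun g z => ?_) (fun σ z => ?_) hz
    · rw [hs, hs, hu.inl, map_add, hwl, haug, IntertwiningMap.isIntertwining,
        IntertwiningMap.isIntertwining, zero_smul, zero_add]
      abel
    · rw [hs, hs, hu.inr, IntertwiningMap.isIntertwining, IntertwiningMap.isIntertwining, hwr]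
  rw [hs, hdz, map_zero, map_zero, add_zero] at h0
  obtain ⟨r, hr⟩ := QuotientGroup.mk_surjective (Additive.toMul (u z))
  refine ⟨r, (QuotientGroup.eq_one_iff (r : P)).1 ?_, by rw [hr]; rfl⟩
  have h1 : q (Additive.toMul (u z)) = 1 := h0
  rw [← hr, hq] at h1
  exact h1

/-- On the elements of `Ker d` that vanish in the coinvariants of `Q₁`, the kernel of `u` consists of
elements that vanish in the coinvariants of `Ker d`. The homotopy `h₀` between `y ↦ f(y) e` and the
identity gives a projection `κ(z) = z + h₀ d z - L f d z` of `Q₁` to `Ker d`, where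
`L(g) = D(γ g)`. Modulo `kerAug d` it deviates from invariance exactly as `Ψ u` does, where `Ψ` is
induced by `D`, and it is the identity on `Ker d`. -/
lemma IsFactorPrimitive.mem_kerAug (haug : ∀ z, aug G (f (d z)) = 0) {D : P → Q₁}
    (hD : ∀ p q, D (p * q) = D p + ρ₁ (.inl (τ p)) (D q))
    (hDσ : ∀ (σ : Γ) p, D (σ • p) = ρ₁ (.inr σ) (D p)) {e : Q₀}
    (hdD : ∀ p, d (D p) = ρ₀ (.inl (τ p)) e - e)
    (h₀ : ρ₀.IntertwiningMap ρ₁)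
    (hh₀ : ∀ y, d (h₀ y) = Finsupp.linearCombination ℤ (fun g => ρ₀ (.inl g) e) (f y) - y)
    {z : Q₁} (hz : z ∈ Coinvariants.ker ρ₁) (hdz : d z = 0) (huz : u z = 0) : z ∈ kerAug d := by
  -- the `ℤ`-module structures are the canonical ones
  obtain rfl : ‹Module ℤ Q₁› = AddCommGroup.toIntModule Q₁ := Subsingleton.elim _ _
  obtain rfl : ‹Module ℤ Q₀› = AddCommGroup.toIntModule Q₀ := Subsingleton.elim _ _
  have hdD0 {r : P} (hr : r ∈ ker τ) : d (D r) = 0 := by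
    rw [hdD, mem_ker.1 hr]
    simp
  -- `Ψ : R / [P, R]_Γ → Ker d / kerAug d` induced by `D`
  let Ψ₀ : ker τ →* Multiplicative (Q₁ ⧸ kerAug d) :=
    MonoidHom.mk' (fun r => .ofAdd ((kerAug d).mkQ (D r))) fun r s => by
      change Multiplicative.ofAdd ((kerAug d).mkQ (D (r * s : P))) = _
      rw [hD, mem_ker.1 r.2, map_one, map_one, Module.End.one_apply, map_add]
      rfl
  have hΨ₀ : kerCommutator τ ≤ Ψ₀.ker.map (ker τ).subtype := by
    refine (Subgroup.closure_le _).2 ?_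
    rintro _ ⟨x, y, hy, σ, rfl⟩
    have hσy : σ • y ∈ ker τ := smul_mem_ker τ σ y hy
    have hxy : x * σ • y * x⁻¹ ∈ ker τ := conj_smul_mem_ker x σ hy
    refine ⟨⟨_, mul_mem hxy (inv_mem hy)⟩, ?_, rfl⟩
    change Multiplicative.ofAdd ((kerAug d).mkQ (D (x * σ • y * x⁻¹ * y⁻¹))) = .ofAdd 0
    rw [crossedHom_mul_inv hD ((mem_ker.1 hxy).trans (mem_ker.1 hy).symm), crossedHom_conj hD x hσy,
      hDσ, map_sub, mkQ_kerAug _ (by rw [IntertwiningMap.isIntertwining, hdD0 hy, map_zero]),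
      mkQ_kerAug _ (hdD0 hy), sub_self]
  let Ψ : KerQuotient τ →* Multiplicative (Q₁ ⧸ kerAug d) := QuotientGroup.lift _ Ψ₀ fun r hr => by
    obtain ⟨s, hs, hsr⟩ := hΨ₀ hr
    rwa [← Subtype.ext hsr]
  let Ψ' : Additive (KerQuotient τ) →+ Q₁ ⧸ kerAug d := MonoidHom.toAdditiveLeft Ψ
  have hΨ (r : P) (hr : r ∈ ker τ) :
      Ψ' (Additive.ofMul ((⟨r, hr⟩ : ker τ) : KerQuotient τ)) = (kerAug d).mkQ (D r) := rfl
  let L : (G →₀ ℤ) →ₗ[ℤ] Q₁ := Finsupp.linearCombination ℤ fun g => D (γ g)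
  have hL (g : G) (n : ℤ) : L (.single g n) = n • D (γ g) := by simp [L]
  have hLr (σ : Γ) (x) : L (groupRing Γ G (.inr σ) x) = ρ₁ (.inr σ) (L x) := by
    induction x using Finsupp.induction_linear with
    | zero => simp
    | add x y hx hy => simp only [map_add, hx, hy]
    | single k n => simp [groupRing_single, hL, map_smul γ, hDσ]
  have hdL (x) : d (L x) =
      Finsupp.linearCombination ℤ (fun g => ρ₀ (.inl g) e) x - aug G x • e := by
    induction x using Finsupp.induction_linear with
    | zero => simp
    | add x y hx hy => simp only [map_add, hx, hy, add_smul]; abel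
    | single k n => simp [hL, aug_single, hdD, hγ, smul_sub]
  have hΨl (g : G) (x) : Ψ' (factorMap γ hγ g x) =
      (kerAug d).mkQ (aug G x • D (γ g) + ρ₁ (.inl g) (L x) - L (groupRing Γ G (.inl g) x)) := by
    induction x using Finsupp.induction_linear with
    | zero => simp
    | add x y hx hy =>
      simp only [map_add, hx, hy, add_smul]
      rw [← map_add]
      congr 1
      abel
    | single k n =>
      rw [groupRing_single, factorMap_single, aug_single, hL, hL, map_smul (ρ₁ (.inl g)),
        ← smul_add, ← smul_sub, map_smul (kerAug d).mkQ, map_zsmul]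
      congr 1
      rw [factorSet, hΨ, crossedHom_mul_inv hD (by simp [hγ]), hD, hγ]
      simp
  let κ : Q₁ →ₗ[ℤ] Q₁ :=
    LinearMap.id + h₀.toLinearMap ∘ₗ d.toLinearMap - L ∘ₗ f.toLinearMap ∘ₗ d.toLinearMap
  have hκ (z : Q₁) : κ z = z + h₀ (d z) - L (f (d z)) := rfl
  have hdκ (z : Q₁) : d (κ z) = 0 := by
    rw [hκ, map_sub, map_add, hh₀, hdL, haug]
    simp
  let s : Q₁ →+ Q₁ ⧸ kerAug d :=
    ((kerAug d).mkQ ∘ₗ κ).toAddMonoidHom - Ψ'.comp u.toAddMonoidHom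
  have hs (z : Q₁) : s z = (kerAug d).mkQ (κ z) - Ψ' (u z) := rfl
  have h0 : s z = 0 := by
    refine map_eq_zero_of_mem_ker s (fun g z => ?_) (fun σ z => ?_) hz
    · rw [hs, hs, hu.inl, map_add, hΨl, haug, ← mkQ_kerAug (.inl g) (hdκ z), zero_smul, zero_add,
        sub_add_eq_sub_sub_swap, ← map_sub]
      congr 2
      simp only [hκ, IntertwiningMap.isIntertwining, map_add, map_sub]
      abel
    · rw [hs, hs, hu.inr, ← mkQ_kerAug (.inr σ) (hdκ z)]
      congr 2
      simp only [hκ, IntertwiningMap.isIntertwining, map_add, map_sub, hLr]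
  rw [hs, huz, map_zero, sub_zero, hκ, hdz] at h0
  simpa using h0

end Comparison

/-! ### The low degrees of a resolution -/

section LowDegrees

/-- The homomorphism of `G ⋊ Γ`-modules `ℤ[G] → Q` sending `1` to a `Γ`-invariant element. -/
def orbitMap {Q : Type uM} [AddCommGroup Q] [Module ℤ Q]
    (ρ : Representation ℤ (Semidirect Γ G) Q) (e : Q) (he : ∀ σ : Γ, ρ (.inr σ) e = e) :
    (groupRing Γ G).IntertwiningMap ρ :=
  LinearMap.intertwiningMap_of_isIntertwiningMap _ _
    (Finsupp.linearCombination ℤ fun g => ρ (.inl g) e) fun t x => by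
      obtain rfl : ‹Module ℤ Q› = AddCommGroup.toIntModule Q := Subsingleton.elim _ _
      induction x using Finsupp.induction_linear with
      | zero => simp
      | add x y hx hy => simp only [map_add, hx, hy]
      | single g n =>
        rw [groupRing_single, Finsupp.linearCombination_single, Finsupp.linearCombination_single,
          map_smul]
        congr 1
        have ht : ρ t = ρ (.inl t.left) * ρ (.inr t.right) := by
          rw [← map_mul, SemidirectProduct.inl_left_mul_inr_right]
        rw [ht, Module.End.mul_apply, inr_inl, he, map_mul, map_mul, Module.End.mul_apply]

lemma orbitMap_apply {Q : Type uM} [AddCommGroup Q] [Module ℤ Q]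
    {ρ : Representation ℤ (Semidirect Γ G) Q} {e : Q} {he : ∀ σ : Γ, ρ (.inr σ) e = e}
    (x : G →₀ ℤ) :
    orbitMap ρ e he x = Finsupp.linearCombination ℤ (fun g => ρ (.inl g) e) x := rfl

variable (Γ G) in
/-- The augmentation `ℤ[G] → ℤ` as a homomorphism of `G ⋊ Γ`-modules. -/
def augMap : (groupRing Γ G).IntertwiningMap (trivialModule.{uΓ, uG, uM} Γ G ℤ).ρ :=
  LinearMap.intertwiningMap_of_isIntertwiningMap _ _
    (ULift.moduleEquiv.symm.toLinearMap ∘ₗ aug G) fun t x => by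
      simp [aug_groupRing]

lemma augMap_apply (x : G →₀ ℤ) : augMap.{uΓ, uG, uM} Γ G x = ULift.up (aug G x) := rfl

/-- The comparison map `u` from the kernel of `d : Q₁ → Q₀` to `R / [P, R]_Γ`: it is invariant and
restricts to a bijection, modulo `kerAug d`, from the elements that vanish in the coinvariants of
`Q₁` to `(R ∩ [P, P]_Γ) / [P, R]_Γ`. The `ℤ`-module structures are implicit arguments because those
of objects of `Rep` are not definitionally the canonical ones. -/
theorem exists_comparison (hτ : IsProjectivePresentation τ)
    {Q₁ : Type uM} [AddCommGroup Q₁] {_ : Module ℤ Q₁} {ρ₁ : Representation ℤ (Semidirect Γ G) Q₁}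
    {Q₀ : Type uM} [AddCommGroup Q₀] {_ : Module ℤ Q₀} {ρ₀ : Representation ℤ (Semidirect Γ G) Q₀}
    (d : ρ₁.IntertwiningMap ρ₀)
    (a : ρ₀.IntertwiningMap (trivialModule.{uΓ, uG, uM} Γ G ℤ).ρ)
    (h₁ : IsRelativelyProjective (Rep.of ρ₁)) (h₀ : IsRelativelyProjective (Rep.of ρ₀))
    (ha : IsProperExact (Rep.ofHom a) (0 : trivialModule.{uΓ, uG, uM} Γ G ℤ ⟶ trivialModule Γ G ℤ))
    (hd : IsProperExact (Rep.ofHom d) (Rep.ofHom a)) :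
    ∃ u : Q₁ →ₗ[ℤ] Additive (KerQuotient τ),
      (∀ t z, d z = 0 → u (ρ₁ t z) = u z) ∧
      (∀ z ∈ Coinvariants.ker ρ₁, d z = 0 →
        ∃ r : ker τ, (r : P) ∈ derived Γ P ∧ u z = Additive.ofMul (r : KerQuotient τ)) ∧
      (∀ r : ker τ, (r : P) ∈ derived Γ P → ∃ z ∈ Coinvariants.ker ρ₁, d z = 0 ∧
        u z = Additive.ofMul (r : KerQuotient τ)) ∧
      ∀ z ∈ Coinvariants.ker ρ₁, d z = 0 → u z = 0 → z ∈ kerAug d := by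
  -- the `ℤ`-module structures are the canonical ones
  obtain rfl : ‹Module ℤ Q₁› = AddCommGroup.toIntModule Q₁ := Subsingleton.elim _ _
  obtain rfl : ‹Module ℤ Q₀› = AddCommGroup.toIntModule Q₀ := Subsingleton.elim _ _
  obtain ⟨γ, hγ⟩ := hτ.exists_section
  obtain ⟨-, γa, hγa⟩ := ha
  obtain ⟨hda, γd, hγd⟩ := hd
  replace hda (z : Q₁) : a (d z) = 0 := congr($hda z)
  replace hγa : ∀ b, a (γa b) = b ∧ _ := fun b => hγa b rfl
  replace hγd : ∀ b, a b = 0 → d (γd b) = b ∧ ∀ σ : Γ, γd (ρ₀ (.inr σ) b) = ρ₁ (.inr σ) (γd b) :=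
    hγd
  -- a `Γ`-invariant lift of `1`
  let e : Q₀ := γa (ULift.up 1)
  have hae : a e = ULift.up 1 := (hγa _).1
  have he (σ : Γ) : ρ₀ (.inr σ) e = e := ((hγa (ULift.up 1)).2 σ).symm
  have ha_smul (t) (x : Q₀) : a (ρ₀ t x) = a x := IntertwiningMap.isIntertwining _ _ a t x
  obtain ⟨f, hf⟩ := exists_lift h₀ (augMap.{uΓ, uG, uM} Γ G) a
    (fun x => Finsupp.single 1 (a x).down)
    (fun σ x => by rw [groupRing_single, ha_smul]; simp)
    (fun x => by rw [augMap_apply, aug_single])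
  have hf' (x : Q₀) : aug G (f x) = (a x).down := congr(($(hf x)).down)
  have haug (z : Q₁) : aug G (f (d z)) = 0 := by rw [hf', hda]; rfl
  have haO (x : G →₀ ℤ) : a (orbitMap ρ₀ e he x) = ULift.up (aug G x) := by
    rw [orbitMap_apply]
    induction x using Finsupp.induction_linear with
    | zero => simp; rfl
    | add x y hx hy => simp only [map_add, hx, hy]; rfl
    | single g n =>
      rw [Finsupp.linearCombination_single, map_smul, ha_smul, hae, aug_single]
      ext
      simp
  -- a homotopy between `y ↦ f(y) e` and the identity
  let φ : ρ₀.IntertwiningMap ρ₀ := (orbitMap ρ₀ e he).comp f - IntertwiningMap.id ρ₀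
  have hφ (y : Q₀) : φ y = orbitMap ρ₀ e he (f y) - y := rfl
  have haφ (y : Q₀) : a (φ y) = 0 := by
    rw [hφ, map_sub, haO, hf', sub_self]
  obtain ⟨s, hs⟩ := exists_lift h₀ d φ (fun y => γd (φ y))
    (fun σ y => by rw [IntertwiningMap.isIntertwining, (hγd _ (haφ y)).2])
    (fun y => (hγd _ (haφ y)).1)
  obtain ⟨u, hul, hur, -⟩ := exists_twisted_hom h₁
    (Representation.trivial ℤ (Semidirect Γ G) (Additive (KerQuotient τ)))
    (fun g => factorMap γ hγ g ∘ₗ f.toLinearMap ∘ₗ d.toLinearMap)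
    (fun g h x => by
      have := factorMap_mul γ hγ g h (f (d x))
      rw [haug, zero_smul, sub_zero] at this
      simpa [IntertwiningMap.isIntertwining] using this)
    (fun σ g x => by
      have := factorMap_smul γ hγ σ g (f (d x))
      simpa [IntertwiningMap.isIntertwining] using this.symm)
    (fun _ => 0) (by simp)
  have hu : IsFactorPrimitive γ hγ d f u := ⟨hul, hur⟩
  have hae' (p : P) : a (ρ₀ (.inl (τ p)) e - e) = 0 := by rw [map_sub, ha_smul, sub_self]
  obtain ⟨D, hD, hDσ, hdD⟩ := exists_crossedHom ρ₁ hτ.projective τ ρ₀ d e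
    (fun p => γd (ρ₀ (.inl (τ p)) e - e))
    (fun σ p => by rw [← (hγd _ (hae' p)).2, map_sub, inr_inl, he, map_smul])
    (fun p => (hγd _ (hae' p)).1)
  have hfe : aug G (f e) = 1 := by rw [hf', hae]
  refine ⟨u, fun t z hz => ?_, fun z hz hdz => hu.exists_mem_derived haug hz hdz,
    fun r hr => ⟨D r, crossedHom_mem_ker hD hDσ hr, ?_,
      hu.apply_crossedHom hD hDσ hdD he hfe r.2 hr⟩,
    fun z hz hdz huz => hu.mem_kerAug haug hD hDσ hdD s hs hz hdz huz⟩
  · rw [← SemidirectProduct.inl_left_mul_inr_right t, map_mul, Module.End.mul_apply, hu.inl, hu.inr,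
      IntertwiningMap.isIntertwining, hz, map_zero, map_zero, map_zero, add_zero]
  · rw [hdD, mem_ker.1 r.2]
    simp

end LowDegrees

/-! ### Homology of coinvariants -/

section Homology

/-- The homology of a short complex of modules is determined by a linear map on the middle term
whose kernel and image on cycles are known. -/
lemma nonempty_homology_addEquiv {R : Type uX} [Ring R] (S : ShortComplex (ModuleCat.{uM} R))
    {V : Type uA} [AddCommGroup V] [Module R V] {V' : Type uP} [AddGroup V'] (Φ : S.X₂ →ₗ[R] V)
    (j : V' →+ V) (hj : Function.Injective j)
    (h₁ : ∀ x, Φ (S.f.hom x) = 0)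
    (h₂ : ∀ x, S.g.hom x = 0 → Φ x = 0 → ∃ y, S.f.hom y = x)
    (h₃ : ∀ x, S.g.hom x = 0 → ∃ v, j v = Φ x)
    (h₄ : ∀ v, ∃ x, S.g.hom x = 0 ∧ j v = Φ x) :
    Nonempty (S.homology ≃+ V') := by
  have hle : LinearMap.range S.moduleCatToCycles ≤
      LinearMap.ker (Φ ∘ₗ (LinearMap.ker S.g.hom).subtype) := by
    rintro _ ⟨y, rfl⟩
    exact h₁ y
  let Φ' := Submodule.liftQ _ (Φ ∘ₗ (LinearMap.ker S.g.hom).subtype) hle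
  have hinj : Function.Injective Φ'.toAddMonoidHom := by
    refine LinearMap.ker_eq_bot.1 (Submodule.ker_liftQ_eq_bot _ _ hle fun x hx => ?_)
    obtain ⟨y, hy⟩ := h₂ x.1 x.2 hx
    exact ⟨y, Subtype.ext hy⟩
  have hrange : Φ'.toAddMonoidHom.range = j.range := by
    ext v
    constructor
    · rintro ⟨x, rfl⟩
      obtain ⟨x, rfl⟩ := Submodule.Quotient.mk_surjective _ x
      exact h₃ x.1 x.2
    · rintro ⟨v, rfl⟩
      obtain ⟨x, hx, hv⟩ := h₄ v
      exact ⟨Submodule.Quotient.mk ⟨x, hx⟩, hv.symm⟩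
  exact ⟨S.moduleCatHomologyIso.toLinearEquiv.toAddEquiv.trans <|
    (AddMonoidHom.ofInjective hinj).trans <|
      (AddEquiv.addSubgroupCongr hrange).trans (AddMonoidHom.ofInjective hj).symm⟩

variable {k : Type} [CommRing k] {Q : Type uM} [AddCommGroup Q] {_ : Module k Q}

/-- The canonical surjection `Q → Q ⊗ k`, the tensor product being taken over `G ⋊ Γ`. -/
def tensorMk (ρ : Representation k (Semidirect Γ G) Q) :
    Q →ₗ[k] Coinvariants (ρ.tprod (trivialModule.{uΓ, uG, 0} Γ G k).ρ) :=
  Coinvariants.mk _ ∘ₗ (TensorProduct.mk k Q (ULift.{0} k)).flip (ULift.up 1)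

variable {ρ : Representation k (Semidirect Γ G) Q}

lemma tensorMk_surjective : Function.Surjective (tensorMk ρ) := by
  intro x
  obtain ⟨x, rfl⟩ := Coinvariants.mk_surjective _ x
  induction x using TensorProduct.induction_on with
  | zero => exact ⟨0, by simp⟩
  | tmul b n =>
    refine ⟨n.down • b, congrArg (Coinvariants.mk _) ?_⟩
    refine (TensorProduct.smul_tmul n.down b (ULift.up 1)).trans ?_
    congr 1
    ext
    simp
  | add x y hx hy =>
    obtain ⟨b, hb⟩ := hx
    obtain ⟨c, hc⟩ := hy
    exact ⟨b + c, by rw [map_add, map_add, hb, hc]⟩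

/-- An invariant map on `Q` factors through `Q ⊗ k`. -/
lemma exists_tensor_lift {V : Type uA} [AddCommGroup V] [Module k V] (F : Q →ₗ[k] V)
    (hF : ∀ t b, F (ρ t b) = F b) :
    ∃ Φ : Coinvariants (ρ.tprod (trivialModule.{uΓ, uG, 0} Γ G k).ρ) →ₗ[k] V,
      ∀ b, Φ (tensorMk ρ b) = F b := by
  let e : TensorProduct k Q (ULift.{0} k) →ₗ[k] Q :=
    (TensorProduct.rid k Q).toLinearMap ∘ₗ LinearMap.lTensor Q ULift.moduleEquiv.toLinearMap
  have he (b : Q) (n : ULift k) : e (TensorProduct.tmul k b n) = n.down • b := rfl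
  refine ⟨Coinvariants.lift _ (F ∘ₗ e) fun t => ?_, fun b => ?_⟩
  · refine TensorProduct.ext' fun b n => ?_
    change F (e (TensorProduct.tmul k (ρ t b) n)) = F (e (TensorProduct.tmul k b n))
    rw [he, he, map_smul, map_smul, hF]
  · change F ((1 : k) • b) = F b
    rw [one_smul]

lemma exists_tensor_lift_comp {Q' : Type uM} [AddCommGroup Q'] {_ : Module k Q'}
    {ρ' : Representation k (Semidirect Γ G) Q'} (d : ρ.IntertwiningMap ρ')
    {V : Type uA} [AddCommGroup V] [Module k V] (u : Q' →ₗ[k] V)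
    (h : ∀ t b, u (ρ' t (d b)) = u (d b)) :
    ∃ Φ : Coinvariants (ρ.tprod (trivialModule.{uΓ, uG, 0} Γ G k).ρ) →ₗ[k] V,
      ∀ b, Φ (tensorMk ρ b) = u (d b) :=
  exists_tensor_lift (u ∘ₗ d.toLinearMap) fun t b =>
    (congrArg u (IntertwiningMap.isIntertwining _ _ d t b)).trans (h t b)

lemma tensorMk_eq_zero {b : Q} : tensorMk ρ b = 0 ↔ b ∈ Coinvariants.ker ρ := by
  rw [← Coinvariants.mk_eq_zero]
  constructor
  · intro h
    obtain ⟨Φ, hΦ⟩ := exists_tensor_lift (Coinvariants.mk ρ) (Coinvariants.mk_self_apply ρ)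
    rw [← hΦ, h, map_zero]
  · intro h
    have h' : Coinvariants.lift ρ (tensorMk ρ) (fun t => LinearMap.ext fun b =>
        Coinvariants.mk_self_apply (ρ.tprod (trivialModule.{uΓ, uG, 0} Γ G k).ρ) t
          (TensorProduct.tmul k b (ULift.up 1))) (Coinvariants.mk ρ b) = tensorMk ρ b := rfl
    rw [← h', h, map_zero]

/-- Right exactness of coinvariants: if `d₂` maps onto the kernel of `d₁`, then an element of the
kernel of `d₁` that vanishes in its coinvariants lifts along `d₂` to one with the same property. -/
lemma exists_mem_ker_of_mem_kerAug
    {Q₂ : Type uM} [AddCommGroup Q₂] {_ : Module ℤ Q₂} {ρ₂ : Representation ℤ (Semidirect Γ G) Q₂}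
    {Q₁ : Type uM} [AddCommGroup Q₁] {_ : Module ℤ Q₁} {ρ₁ : Representation ℤ (Semidirect Γ G) Q₁}
    {Q₀ : Type uM} [AddCommGroup Q₀] {_ : Module ℤ Q₀} {ρ₀ : Representation ℤ (Semidirect Γ G) Q₀}
    {d₂ : ρ₂.IntertwiningMap ρ₁} {d₁ : ρ₁.IntertwiningMap ρ₀}
    (hd : ∀ z, d₁ z = 0 → ∃ y, d₂ y = z) {z : Q₁} (hz : z ∈ kerAug d₁) :
    ∃ y ∈ Coinvariants.ker ρ₂, d₂ y = z := by
  have hle : kerAug d₁ ≤ (Coinvariants.ker ρ₂).map d₂.toLinearMap := by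
    refine Submodule.span_le.2 ?_
    rintro _ ⟨t, y, hy, rfl⟩
    obtain ⟨y, rfl⟩ := hd y hy
    refine ⟨_, Coinvariants.sub_mem_ker t y, ?_⟩
    simp [IntertwiningMap.isIntertwining]
  exact hle hz

end Homology

/-! ### The Hopf formula -/

section Hopf

/-- The inclusion of `(R ∩ [P, P]_Γ) / [P, R]_Γ` in `R / [P, R]_Γ`. -/
def hopfInclusion (τ : P →*[Γ] G) : HopfQuotient τ →* KerQuotient τ :=
  QuotientGroup.map _ _ (Subgroup.inclusion inf_le_left) fun _ hr => hr

lemma hopfInclusion_injective : Function.Injective (hopfInclusion τ) := by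
  rw [injective_iff_map_eq_one]
  intro x
  induction x using QuotientGroup.induction_on with
  | H r =>
    intro h
    exact (QuotientGroup.eq_one_iff r).2
      ((QuotientGroup.eq_one_iff (N := (kerCommutator τ).subgroupOf (ker τ)) _).1 h)

/-- The isomorphism is induced by `x ↦ u(d₂ x)` on `Q₂`. -/
theorem nonempty_integralHomology_two_addEquiv (hτ : IsProjectivePresentation τ)
    (Q : RelativeResolution (trivialModule.{uΓ, uG, uM} Γ G ℤ)) :
    Nonempty (integralHomology Q 2 ≃+ Additive (HopfQuotient τ)) := by
  obtain ⟨u, hu_inv, hu_range, hu_surj, hu_ker⟩ := exists_comparison hτ (Q.complex.d 1 0).hom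
    Q.augmentation.hom (Q.projective 1) (Q.projective 0) Q.exact_aug Q.exact_zero
  obtain ⟨hd₁, γ₁, hγ₁⟩ := Q.exact_succ 0
  obtain ⟨hd₂, γ₂, hγ₂⟩ := Q.exact_succ 1
  let d₃ := (Q.complex.d 3 2).hom
  let d₂ := (Q.complex.d 2 1).hom
  let d₁ := (Q.complex.d 1 0).hom
  have hd₂₁ (x) : d₁ (d₂ x) = 0 := congr($hd₁ x)
  have hd₃₂ (x) : d₂ (d₃ x) = 0 := congr($hd₂ x)
  obtain ⟨Φ, hΦ⟩ := exists_tensor_lift_comp d₂ u fun t x => hu_inv t _ (hd₂₁ x)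
  let C := ((tensorFunctor.{uΓ, uG, uM, 0} (trivialModule.{uΓ, uG, 0} Γ G ℤ)).mapHomologicalComplex
    (ComplexShape.down ℕ)).obj Q.complex
  let S := C.sc' 3 2 1
  have hf (x) : S.f.hom (tensorMk (Q.complex.X 3).ρ x) = tensorMk (Q.complex.X 2).ρ (d₃ x) := rfl
  have hg (x) : S.g.hom (tensorMk (Q.complex.X 2).ρ x) = tensorMk (Q.complex.X 1).ρ (d₂ x) := rfl
  have hS : Nonempty (S.homology ≃+ Additive (HopfQuotient τ)) := by
    refine nonempty_homology_addEquiv S Φ (hopfInclusion τ).toAdditive hopfInclusion_injective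
      (fun x => ?_) (fun x hx hx' => ?_) (fun x hx => ?_) (fun v => ?_)
    · obtain ⟨x, rfl⟩ := tensorMk_surjective x
      exact (hΦ (d₃ x)).trans (by rw [hd₃₂, map_zero])
    · obtain ⟨x, rfl⟩ := tensorMk_surjective x
      replace hx := tensorMk_eq_zero.1 ((hg x).symm.trans hx)
      have h := hu_ker _ hx (hd₂₁ x) ((hΦ x).symm.trans hx')
      obtain ⟨y, hy, hyx⟩ := exists_mem_ker_of_mem_kerAug (d₂ := d₂)
        (fun z hz => ⟨γ₁ z, (hγ₁ z hz).1⟩) h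
      have hxy : d₂ (x - y) = 0 := by rw [map_sub, hyx, sub_self]
      refine ⟨tensorMk _ (γ₂ (x - y)), ?_⟩
      refine (hf _).trans ?_
      have hd₃ : d₃ (γ₂ (x - y)) = x - y := (hγ₂ _ hxy).1
      rw [hd₃, map_sub, tensorMk_eq_zero.2 hy, sub_zero]
    · obtain ⟨x, rfl⟩ := tensorMk_surjective x
      replace hx := tensorMk_eq_zero.1 ((hg x).symm.trans hx)
      obtain ⟨r, hr, hur⟩ := hu_range _ hx (hd₂₁ x)
      refine ⟨Additive.ofMul ((⟨r, r.2, hr⟩ : ↥(ker τ ⊓ derived Γ P)) : HopfQuotient τ), ?_⟩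
      exact (hur.symm.trans (hΦ x).symm)
    · obtain ⟨r, hr⟩ := QuotientGroup.mk_surjective (Additive.toMul v)
      obtain ⟨z, hz, hdz, huz⟩ := hu_surj ⟨r, r.2.1⟩ r.2.2
      have hz' : d₂ (γ₁ z) = z := (hγ₁ z hdz).1
      refine ⟨tensorMk _ (γ₁ z), ?_, ?_⟩
      · exact (hg _).trans (tensorMk_eq_zero.2 (hz'.symm ▸ hz))
      · refine Eq.trans ?_ (hΦ _).symm
        rw [hz', huz]
        change Additive.ofMul (hopfInclusion τ (Additive.toMul v)) = _
        rw [← hr]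
        rfl
  obtain ⟨e⟩ := hS
  let i := ShortComplex.homologyMapIso (C.isoSc' 3 2 1 (by simp) (by simp))
  exact ⟨i.toLinearEquiv.toAddEquiv.trans e⟩

end Hopf

end

end EquivariantHomology

theorem theorem17 {Γ : Type uΓ} [Group Γ] {G : Type uG} [Group G] [MulDistribMulAction Γ G]
    {P : Type uP} [Group P] [MulDistribMulAction Γ P] (τ : P →*[Γ] G)
    (hτ : GammaGroup.IsProjectivePresentation τ) :
    (GammaGroup.IsPerfect Γ G →
      GammaGroup.IsUniversalCentralExtension.{uΓ, uG, uP, uX} (GammaGroup.derivedQuotientMap τ)) ∧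
    ∀ Q : EquivariantHomology.RelativeResolution
        (EquivariantHomology.trivialModule.{uΓ, uG, uM} Γ G ℤ),
      Nonempty
        (EquivariantHomology.integralHomology Q 2 ≃+ Additive (GammaGroup.HopfQuotient τ)) :=
  ⟨GammaGroup.isUniversalCentralExtension_derivedQuotientMap hτ,
    EquivariantHomology.nonempty_integralHomology_two_addEquiv hτ⟩
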